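/- Let $s\ge 2$ and write $x\cdot y=x_0y_0-\sum_{i=1}^s x_iy_i$ for the Minkowski product on $\mathbf R^{1+s}$. Let $V_+=\{x: x_0>0,\ x\cdot x>0\}$. Let $\mathcal H$ be an infinite-dimensional complex Hilbert space, and let $\mathcal A$ assign to every bounded open set $\mathcal O\subset\mathbf R^{1+s}$ a unital $C^*$-algebra $\mathcal A(\mathcal O)$ of bounded operators on $\mathcal H$, such that $\mathcal A(\mathcal O)\subset\mathcal A(P)$ if $\mathcal O\subset P$ (isotony), and the elements of $\mathcal A(\mathcal O)$ commute with those of $\mathcal A(P)$ if $\mathcal O$ and $P$ are spacelike separated (locality). For an unbounded open set $R$ let $\mathcal A(R)$ be the $C^*$-algebra generated by all $\mathcal A(\mathcal O)$ with $\mathcal O\subset R$ bounded and open. Assume: (A) there is a strongly continuous unitary representation $U$ of $(\mathbf R^{1+s},+)$ on $\mathcal H$ with $U(a)\mathcal A(\mathcal O)U(-a)=\mathcal A(\mathcal O+a)$ for all $a\in\mathbf R^{1+s}$ and all bounded open $\mathcal O$; (B) the joint spectrum of the energy-momentum operators $P$, defined by $U(a)=e^{iP\cdot a}$, is contained in the closed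 forward light cone $\overline V_+$; (C) the space of $U$-invariant vectors is one-dimensional, and a unit vector $\Omega$ in it is cyclic for $\mathcal A(\mathbf R^{1+s})$; (D) $\Omega$ is cyclic for $\mathcal A(\mathcal O)$ for every nonempty bounded open $\mathcal O$. A double cone is a set $\mathcal O=(a+V_+)\cap(b-V_+)$ with $a,b\in\mathbf R^{1+s}$. Let $K$ be a unitary or antiunitary operator on $\mathcal H$ such that for every double cone $\mathcal O$ there are open sets $M_{\mathcal O}$ and $N_{\mathcal O}$ (not necessarily bounded) with $$K\mathcal A(\mathcal O)K^*=\mathcal A(M_{\mathcal O}),\qquad K^*\mathcal A(\mathcal O)K=\mathcal A(N_{\mathcal O}).$$ Let $\kappa:\mathbf R^{1+s}\to\mathbf R^{1+s}$ be a causal automorphism, i.e. a bijection such that $(\kappa x-\kappa y)\cdot(\kappa x-\kappa y)>0$ if and only if $(x-y)\cdot(x-y)>0$, and suppose that $$KU(a)K^*=U(\kappa a)\qquad\text{for all }a\in\mathbf R^{1+s}.$$ Then there is a unique $\xi\in\mathbf R^{1+s}$ such that $$K\mathcal A(\mathcal O)K^*=\mathcal A(\kappa\mathcal O+\xi)\qquad\text{for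 all double cones }\mathcal O.$$ -/

import Mathlib

open scoped InnerProductSpace

noncomputable section

/-! ### Minkowski spacetime -/

/-- Minkowski spacetime `ℝ^{1+s}`; the coordinate `0` is time, the other `s` are spatial. -/
abbrev Spacetime (s : ℕ) : Type := Fin (s + 1) → ℝ

/-- The Minkowski product `x·y = x₀y₀ - x₁y₁ - ... - xₛyₛ`. -/
def mink {s : ℕ} (x y : Spacetime s) : ℝ :=
  x 0 * y 0 - ∑ i : Fin s, x i.succ * y i.succ

/-- The open forward light cone `V₊`. -/
def forwardCone (s : ℕ) : Set (Spacetime s) := {x | 0 < x 0 ∧ 0 < mink x x}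

/-- The closed forward light cone. -/
def closedForwardCone (s : ℕ) : Set (Spacetime s) := {x | 0 ≤ x 0 ∧ 0 ≤ mink x x}

/-- The double cone `(a + V₊) ∩ (b - V₊)`. -/
def doubleCone {s : ℕ} (a b : Spacetime s) : Set (Spacetime s) :=
  {x | x - a ∈ forwardCone s ∧ b - x ∈ forwardCone s}

/-- Two points are timelike with respect to each other. -/
def Timelike {s : ℕ} (x y : Spacetime s) : Prop := 0 < mink (x - y) (x - y)

/-- Two sets are spacelike separated. -/
def SpacelikeSeparated {s : ℕ} (O P : Set (Spacetime s)) : Prop :=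
  ∀ x ∈ O, ∀ y ∈ P, mink (x - y) (x - y) < 0

/-- A causal automorphism: a bijection such that two points are timelike with respect to each
other if and only if their images are (neither linear nor continuous by definition). -/
structure IsCausalAutomorphism {s : ℕ} (κ : Spacetime s → Spacetime s) : Prop where
  bijective : Function.Bijective κ
  timelike_iff : ∀ x y, Timelike (κ x) (κ y) ↔ Timelike x y

/-- A bounded open region of spacetime. -/
structure Region (s : ℕ) where
  carrier : Set (Spacetime s)
  isOpen : IsOpen carrier
  isBounded : Bornology.IsBounded carrier

/-- The translate `O + a`. -/
def Region.translate {s : ℕ} (O : Region s) (a : Spacetime s) : Region s where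
  carrier := {x | x - a ∈ O.carrier}
  isOpen := O.isOpen.preimage (continuous_id.sub continuous_const)
  isBounded := by
    have h : {x | x - a ∈ O.carrier} = (fun x => x + a) '' O.carrier := by
      ext x
      constructor
      · intro hx
        exact ⟨x - a, hx, sub_add_cancel x a⟩
      · rintro ⟨y, hy, rfl⟩
        simpa using hy
    rw [h]
    exact ((LipschitzWith.of_dist_le_mul (K := 1) (by simp)).isBounded_image O.isBounded)

/-! ### Local nets of observables -/

variable {s : ℕ} {H : Type*} [NormedAddCommGroup H] [InnerProductSpace ℂ H] [CompleteSpace H]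

/-- A local net of observables: each bounded open region carries a unital C⋆-algebra of bounded
operators on `H`, subject to isotony and locality. -/
structure LocalNet (s : ℕ) (H : Type*) [NormedAddCommGroup H] [InnerProductSpace ℂ H]
    [CompleteSpace H] where
  alg : Region s → StarSubalgebra ℂ (H →L[ℂ] H)
  isClosed : ∀ O, IsClosed (alg O : Set (H →L[ℂ] H))
  isotony : ∀ O P : Region s, O.carrier ⊆ P.carrier → alg O ≤ alg P
  locality : ∀ O P : Region s, SpacelikeSeparated O.carrier P.carrier →
    ∀ A ∈ alg O, ∀ B ∈ alg P, A * B = B * A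

/-- The algebra `𝒜(R)` of an arbitrary, possibly unbounded, open set `R`: the C⋆-algebra generated
by all `𝒜(O)` with `O` bounded, open and contained in `R`. -/
def LocalNet.algebra (𝒜 : LocalNet s H) (R : Set (Spacetime s)) :
    StarSubalgebra ℂ (H →L[ℂ] H) :=
  (⨆ O : {O : Region s // O.carrier ⊆ R}, 𝒜.alg O.1).topologicalClosure

/-- For a bounded open region, `𝒜(O)` is the algebra given by the net. -/
theorem LocalNet.algebra_eq (𝒜 : LocalNet s H) (O : Region s) :
    𝒜.algebra O.carrier = 𝒜.alg O := by
  apply le_antisymm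
  · exact StarSubalgebra.topologicalClosure_minimal
      (iSup_le fun P => 𝒜.isotony _ _ P.2) (𝒜.isClosed O)
  · exact le_trans (le_iSup (fun P : {P : Region s // P.carrier ⊆ O.carrier} => 𝒜.alg P.1)
      ⟨O, subset_rfl⟩) (StarSubalgebra.le_topologicalClosure _)

/-- A strongly continuous unitary representation of the translation group. -/
structure TranslationRep (s : ℕ) (H : Type*) [NormedAddCommGroup H] [InnerProductSpace ℂ H]
    [CompleteSpace H] where
  U : Spacetime s → unitary (H →L[ℂ] H)
  map_add : ∀ a b, U (a + b) = U a * U b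
  continuous : ∀ ψ : H, Continuous fun a => (U a : H →L[ℂ] H) ψ

/-- The operator `U(a)`. -/
def TranslationRep.op (U : TranslationRep s H) (a : Spacetime s) : H →L[ℂ] H := U.U a

/-- Translation covariance: `U(a) 𝒜(O) U(-a) = 𝒜(O + a)`. -/
def TranslationCovariant (𝒜 : LocalNet s H) (U : TranslationRep s H) : Prop :=
  ∀ (O : Region s) (a : Spacetime s),
    (fun A => U.op a * A * U.op (-a)) '' (𝒜.alg O : Set (H →L[ℂ] H)) = 𝒜.alg (O.translate a)

/-- Spectrum condition. Writing `U(a) = exp(i P·a) = ∫ exp(i p·a) dE(p)`, where `E` is the joint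
spectral measure of the energy-momentum operators, `μ` is the measure `⟨ψ, E(·) ψ⟩`; it is
determined by its Fourier transform. The joint spectrum, that is the support of `E`, lies in the
closed forward light cone if and only if each of these measures is carried by that cone. -/
def SpectrumCondition (U : TranslationRep s H) : Prop :=
  ∀ ψ : H, ∃ μ : MeasureTheory.Measure (Spacetime s), MeasureTheory.IsFiniteMeasure μ ∧
    (∀ a : Spacetime s,
      ⟪ψ, U.op a ψ⟫_ℂ = ∫ p, Complex.exp (Complex.I * (mink p a : ℂ)) ∂μ) ∧
    μ (closedForwardCone s)ᶜ = 0

/-- The space of `U`-invariant vectors. -/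
def TranslationRep.invariants (U : TranslationRep s H) : Submodule ℂ H where
  carrier := {ψ | ∀ a, U.op a ψ = ψ}
  add_mem' := by
    intro x y hx hy a
    rw [_root_.map_add, hx a, hy a]
  zero_mem' := fun a => map_zero _
  smul_mem' := by
    intro c x hx a
    rw [_root_.map_smul, hx a]

/-- The vector `Ω` is cyclic with respect to the algebra `𝓜`. -/
def Cyclic (𝓜 : StarSubalgebra ℂ (H →L[ℂ] H)) (Ω : H) : Prop :=
  Dense {ψ : H | ∃ A ∈ 𝓜, A Ω = ψ}

/-- Existence and uniqueness of the vacuum: the invariant vectors form a one-dimensional space,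
and `Ω` is a unit vector in it that is cyclic for the algebra of all of spacetime. -/
structure IsVacuum (𝒜 : LocalNet s H) (U : TranslationRep s H) (Ω : H) : Prop where
  finrank_invariants : Module.finrank ℂ U.invariants = 1
  mem_invariants : Ω ∈ U.invariants
  norm_eq_one : ‖Ω‖ = 1
  cyclic : Cyclic (𝒜.algebra Set.univ) Ω

/-- The Reeh-Schlieder property. -/
def ReehSchlieder (𝒜 : LocalNet s H) (Ω : H) : Prop :=
  ∀ O : Region s, O.carrier.Nonempty → Cyclic (𝒜.alg O) Ω

/-- The operator `K A K*`, for a bijective (`σ`-semilinear) isometry `K`, whose adjoint `K*` is its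
inverse. If `σ` is the identity, `K` is unitary; if `σ` is complex conjugation, `K` is
antiunitary. -/
def conjBy {σ σ' : ℂ →+* ℂ} [RingHomInvPair σ σ'] [RingHomInvPair σ' σ]
    (K : H ≃ₛₗᵢ[σ] H) (A : H →L[ℂ] H) : H →L[ℂ] H :=
  (K.toContinuousLinearEquiv : H →SL[σ] H).comp
    (A.comp (K.symm.toContinuousLinearEquiv : H →SL[σ'] H))

end

/-!
# A symmetry that normalises the translations acts geometrically on double cones

Write `D(p, v)` for the double cone with centre `p` and half-axis `v`.

*Analytic input.* If `A` commutes with all translates `B(t)` of `B` along a causal line, then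
`⟨Ω, A B(t) Ω⟩ = ⟨Ω, B(t) A Ω⟩` is, by the spectrum condition, the Fourier transform of a complex
measure on `[0, ∞)` and of one on `(-∞, 0]`, so that it is constant in `t`
(`IsPositiveEnergy.eq_const`). If this holds for all observables `A` and `B` of two nonempty
regions, the Reeh-Schlieder property makes the translations along the line trivial. All momenta are
then orthogonal to the line, some spacelike translation is trivial, and by locality everything
commutes with everything: the same argument for the time axis shows that every vector is invariant,
which is absurd in infinite dimension (`not_forall_commute_along_causal_line`).
Consequences: the net admits no nontrivial shift (`eq_zero_of_alg_le`), the translations act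
faithfully, and `κ` is therefore additive. An additive causal automorphism maps `V₊` onto `V₊` or
onto `-V₊`, which is all of Zeeman's theorem that is needed; let `ε = ±1` be the sign with
`ε κ(V₊) = V₊`.

*Localisation.* Let `K 𝒜(D(p, v)) K* = 𝒜(M)` and `K 𝒜(D(q, w)) K* = 𝒜(N)`, and let `x ∈ M` and
`y ∈ N`; put `V = ε κ(v + w)`. Small regions at `x` and at `y + c` have commuting observables if
they are spacelike separated, and also if `D(p, v)` and `D(q, w) + κ⁻¹ c` are. With
`δ = (y - κ q) - (x - κ p)`, if `δ · e > V · e` for some lightlike `e`, then there is a line of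
translations `c` in the direction `e` one half of which is covered by the first criterion and the
other by the second
(`exists_lightlike_line`), contrary to the analytic input. Hence `V ± δ` lie in the closed cone
(`VacuumNet.sub_mem_closedForwardCone`). Commutativity of the observables of two regions alone would
not suffice, as it does not imply that they are spacelike separated (Huygens' principle).

For double cones shrinking to the origin this makes points of their localisation regions converge
to a vector `ξ`, and then `K 𝒜(D(p, v)) K* ⊆ 𝒜(D(κ p + ξ, ε κ v))`
(`VacuumNet.exists_localisation`). The same holds for `K*` and `κ⁻¹`; the composition of the two
inclusions shifts the net by a constant vector, which vanishes, so that the inclusions are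
equalities. Two different `ξ` would again give a nontrivial shift of the net. For an empty double
cone the algebra consists of scalars, which `K` preserves.
-/

/-! ### Minkowski geometry -/

section Geometry

variable {s : ℕ}

theorem mink_comm (x y : Spacetime s) : mink x y = mink y x := by
  simp only [mink, mul_comm]

theorem mink_add_left (x y z : Spacetime s) : mink (x + y) z = mink x z + mink y z := by
  simp only [mink, Pi.add_apply, add_mul, Finset.sum_add_distrib]; ring

theorem mink_smul_left (c : ℝ) (x y : Spacetime s) : mink (c • x) y = c * mink x y := by
  simp only [mink, Pi.smul_apply, smul_eq_mul, mul_sub, Finset.mul_sum, mul_assoc]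

theorem mink_neg_left (x y : Spacetime s) : mink (-x) y = -mink x y := by
  rw [← neg_one_smul ℝ x, mink_smul_left]; ring

theorem mink_sub_left (x y z : Spacetime s) : mink (x - y) z = mink x z - mink y z := by
  rw [sub_eq_add_neg, mink_add_left, mink_neg_left]; ring

theorem mink_add_right (x y z : Spacetime s) : mink x (y + z) = mink x y + mink x z := by
  rw [mink_comm, mink_add_left, mink_comm y, mink_comm z]

theorem mink_smul_right (c : ℝ) (x y : Spacetime s) : mink x (c • y) = c * mink x y := by
  rw [mink_comm, mink_smul_left, mink_comm y]

theorem mink_neg_right (x y : Spacetime s) : mink x (-y) = -mink x y := by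
  rw [mink_comm, mink_neg_left, mink_comm y]

theorem continuous_mink {X : Type*} [TopologicalSpace X] {f g : X → Spacetime s}
    (hf : Continuous f) (hg : Continuous g) : Continuous fun x => mink (f x) (g x) := by
  unfold mink; fun_prop

/-- The unit vector of the time axis. -/
def timeUnit (s : ℕ) : Spacetime s := Fin.cons 1 0

/-- The purely spatial vector with components `m`. -/
def spatial (m : Fin s → ℝ) : Spacetime s := Fin.cons 0 m

@[simp] theorem timeUnit_zero : timeUnit s 0 = 1 := rfl
@[simp] theorem timeUnit_succ (i : Fin s) : timeUnit s i.succ = 0 := rfl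
@[simp] theorem spatial_zero (m : Fin s → ℝ) : spatial m 0 = 0 := rfl
@[simp] theorem spatial_succ (m : Fin s → ℝ) (i : Fin s) : spatial m i.succ = m i := rfl

theorem mink_timeUnit_right (x : Spacetime s) : mink x (timeUnit s) = x 0 := by simp [mink]

theorem mink_self_le (x : Spacetime s) : mink x x ≤ x 0 * x 0 := by
  have : 0 ≤ ∑ i : Fin s, x i.succ * x i.succ :=
    Finset.sum_nonneg fun i _ => mul_self_nonneg _
  unfold mink; linarith

theorem timeUnit_mem : timeUnit s ∈ forwardCone s := by
  simp [forwardCone, mink]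

theorem forwardCone_subset : forwardCone s ⊆ closedForwardCone s :=
  fun _ hx => ⟨hx.1.le, hx.2.le⟩

theorem mink_spatial_neg {m : Fin s → ℝ} (hm : m ≠ 0) : mink (spatial m) (spatial m) < 0 := by
  obtain ⟨i, hi⟩ := Function.ne_iff.mp hm
  have : 0 < ∑ i : Fin s, m i * m i :=
    Finset.sum_pos' (fun i _ => mul_self_nonneg _) ⟨i, Finset.mem_univ _, mul_self_pos.mpr hi⟩
  simpa [mink] using this

theorem sum_mul_le {x y : Spacetime s} (hx : x ∈ closedForwardCone s)
    (hy : y ∈ closedForwardCone s) : ∑ i : Fin s, x i.succ * y i.succ ≤ x 0 * y 0 := by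
  have h := Finset.sum_mul_sq_le_sq_mul_sq Finset.univ (fun i : Fin s => x i.succ)
    (fun i => y i.succ)
  have hx' : ∑ i : Fin s, x i.succ ^ 2 ≤ x 0 ^ 2 := by
    have := hx.2; simp only [mink, ← sq] at this; linarith
  have hy' : ∑ i : Fin s, y i.succ ^ 2 ≤ y 0 ^ 2 := by
    have := hy.2; simp only [mink, ← sq] at this; linarith
  refine abs_le_of_sq_le_sq' ?_ (mul_nonneg hx.1 hy.1) |>.2
  rw [mul_pow]
  exact h.trans (mul_le_mul hx' hy' (Finset.sum_nonneg fun i _ => sq_nonneg _) (sq_nonneg _))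

theorem mink_nonneg {x y : Spacetime s} (hx : x ∈ closedForwardCone s)
    (hy : y ∈ closedForwardCone s) : 0 ≤ mink x y := by
  have := sum_mul_le hx hy
  unfold mink; linarith

theorem closedForwardCone_pos {x : Spacetime s} (hx : x ∈ closedForwardCone s) (h0 : x ≠ 0) :
    0 < x 0 := by
  refine lt_of_le_of_ne hx.1 fun h => h0 ?_
  by_contra hne
  have hm : (fun i : Fin s => x i.succ) ≠ 0 := by
    intro h'
    apply hne
    funext i
    refine Fin.cases h.symm (fun j => ?_) i
    exact congrFun h' j
  have h1 := mink_spatial_neg hm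
  have h2 := hx.2
  simp only [mink, spatial_zero, spatial_succ] at h1 h2
  rw [← h] at h2
  linarith

theorem add_mem_forwardCone {x y : Spacetime s} (hx : x ∈ forwardCone s)
    (hy : y ∈ closedForwardCone s) : x + y ∈ forwardCone s := by
  refine ⟨add_pos_of_pos_of_nonneg hx.1 hy.1, ?_⟩
  have := mink_nonneg (forwardCone_subset hx) hy
  rw [mink_add_left, mink_add_right, mink_add_right, mink_comm y x]
  linarith [hx.2, hy.2]

theorem smul_mem_forwardCone {c : ℝ} (hc : 0 < c) {x : Spacetime s} (hx : x ∈ forwardCone s) :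
    c • x ∈ forwardCone s := by
  refine ⟨mul_pos hc hx.1, ?_⟩
  rw [mink_smul_left, mink_smul_right]
  exact mul_pos hc (mul_pos hc hx.2)

theorem isOpen_forwardCone : IsOpen (forwardCone s) :=
  (isOpen_lt continuous_const (continuous_apply 0)).inter
    (isOpen_lt continuous_const (continuous_mink continuous_id continuous_id))

theorem isClosed_closedForwardCone : IsClosed (closedForwardCone s) :=
  (isClosed_le continuous_const (continuous_apply 0)).inter
    (isClosed_le continuous_const (continuous_mink continuous_id continuous_id))

/-- A vector of the open cone has strictly positive product with every nonzero vector of the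
closed cone. -/
theorem mink_pos {x e : Spacetime s} (hx : x ∈ forwardCone s) (he : e ∈ closedForwardCone s)
    (h0 : e ≠ 0) : 0 < mink x e := by
  -- `x - ε e₀` is still in the cone for small `ε > 0`, and `e₀ · e = e 0 > 0`
  have hc : Continuous fun ε : ℝ => x - ε • timeUnit s := by fun_prop
  have hmem : ∀ᶠ ε in nhds (0 : ℝ), x - ε • timeUnit s ∈ forwardCone s :=
    hc.continuousAt.eventually_mem (by simpa using isOpen_forwardCone.mem_nhds hx)
  obtain ⟨ε, hε, hpos⟩ :=
    ((hmem.filter_mono nhdsWithin_le_nhds).and (self_mem_nhdsWithin (s := Set.Ioi (0 : ℝ)))).exists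
  have h1 := mink_nonneg (forwardCone_subset hε) he
  rw [mink_sub_left, mink_smul_left, mink_comm (timeUnit s), mink_timeUnit_right] at h1
  have := mul_pos hpos (closedForwardCone_pos he h0)
  linarith

/-- The closed forward cone is self-dual; it suffices to test with lightlike vectors. -/
theorem mem_closedForwardCone_of_lightlike (hs : 1 ≤ s) {z : Spacetime s}
    (h : ∀ e : Spacetime s, mink e e = 0 → 0 < e 0 → 0 ≤ mink z e) :
    z ∈ closedForwardCone s := by
  have key : ∀ m : Fin s → ℝ, m ≠ 0 →
      ∑ i, z i.succ * m i ≤ z 0 * √(∑ i, m i * m i) := by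
    intro m hm
    have hm' := mink_spatial_neg hm
    simp only [mink, spatial_zero, spatial_succ] at hm'
    have hp : 0 < ∑ i, m i * m i := by linarith
    have := h (Fin.cons (√(∑ i, m i * m i)) m) (by simp [mink, Real.mul_self_sqrt hp.le])
      (by simpa using hp)
    simp only [mink, Fin.cons_zero, Fin.cons_succ] at this
    linarith
  set q := ∑ i : Fin s, z i.succ * z i.succ with hq
  have hq0 : 0 ≤ q := Finset.sum_nonneg fun i _ => mul_self_nonneg _
  by_cases hz : (fun i : Fin s => z i.succ) = 0
  · have hz' : ∀ i : Fin s, z i.succ = 0 := fun i => congrFun hz i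
    have h1 := key (fun _ => 1) (by
      intro h; exact one_ne_zero (congrFun h (⟨0, hs⟩ : Fin s)))
    simp only [hz', zero_mul, Finset.sum_const_zero] at h1
    have hsq : 0 < √(∑ _i : Fin s, (1 : ℝ) * 1) := by
      simp; omega
    refine ⟨nonneg_of_mul_nonneg_left h1 hsq, ?_⟩
    simp only [mink, hz', mul_zero, Finset.sum_const_zero, sub_zero]
    exact mul_self_nonneg _
  · have h1 := key _ hz
    have hneg := mink_spatial_neg hz
    simp only [mink, spatial_zero, spatial_succ] at hneg
    have hqp : 0 < q := by linarith
    have h2 : √q ≤ z 0 := by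
      have : √q * √q ≤ z 0 * √q := by rw [Real.mul_self_sqrt hq0]; exact h1
      exact le_of_mul_le_mul_right this (Real.sqrt_pos.mpr hqp)
    refine ⟨(Real.sqrt_nonneg _).trans h2, ?_⟩
    have h3 : q ≤ z 0 * z 0 := by
      rw [← Real.mul_self_sqrt hq0]
      exact mul_self_le_mul_self (Real.sqrt_nonneg _) h2
    simp only [mink]; linarith

theorem abs_le_of_mem_closedForwardCone {x : Spacetime s} (hx : x ∈ closedForwardCone s)
    (i : Fin (s + 1)) : |x i| ≤ x 0 := by
  refine Fin.cases (abs_of_nonneg hx.1).le (fun j => ?_) i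
  refine abs_le_of_sq_le_sq ?_ hx.1
  have h1 := hx.2
  have h2 : x j.succ * x j.succ ≤ ∑ i : Fin s, x i.succ * x i.succ :=
    Finset.single_le_sum (f := fun i : Fin s => x i.succ * x i.succ)
      (fun i _ => mul_self_nonneg _) (Finset.mem_univ j)
  simp only [mink] at h1
  nlinarith

/-- A vector between `-v` and `v` in the causal order is bounded by the time component of `v`. -/
theorem norm_le_of_mem {v u : Spacetime s} (h1 : v + u ∈ closedForwardCone s)
    (h2 : v - u ∈ closedForwardCone s) : ‖u‖ ≤ v 0 := by
  have h0 : 0 ≤ v 0 := by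
    have a := h1.1; have b := h2.1
    simp only [Pi.add_apply, Pi.sub_apply] at a b; linarith
  refine (pi_norm_le_iff_of_nonneg h0).mpr fun i => ?_
  have a := abs_le.mp (abs_le_of_mem_closedForwardCone h1 i)
  have b := abs_le.mp (abs_le_of_mem_closedForwardCone h2 i)
  simp only [Pi.add_apply, Pi.sub_apply] at a b
  rw [Real.norm_eq_abs, abs_le]
  constructor <;> linarith

/-- Two double cones, written with centres `p`, `q` and half-axes `v`, `w`, are spacelike
separated unless the difference of the centres is timelike or lightlike relative to a double cone
with half-axis `v + w`. -/
theorem spacelikeSeparated_doubleCone {p v q w : Spacetime s}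
    (h1 : (v + w) + (q - p) ∉ forwardCone s) (h2 : (v + w) - (q - p) ∉ forwardCone s) :
    SpacelikeSeparated (doubleCone (p - v) (p + v)) (doubleCone (q - w) (q + w)) := by
  intro x hx y hy
  by_contra h
  push Not at h
  rcases le_total (x 0) (y 0) with h0 | h0
  · have hc : y - x ∈ closedForwardCone s := by
      refine ⟨by simpa using h0, ?_⟩
      rw [← neg_sub x y, mink_neg_left, mink_neg_right]; simpa using h
    apply h1
    have := add_mem_forwardCone (add_mem_forwardCone hy.2 hc) (forwardCone_subset hx.1)
    convert this using 1; abel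
  · have hc : x - y ∈ closedForwardCone s := ⟨by simpa using h0, h⟩
    apply h2
    have := add_mem_forwardCone (add_mem_forwardCone hx.2 hc) (forwardCone_subset hy.1)
    convert this using 1; abel

theorem spacelikeSeparated_of_mink_nonpos {p v q w : Spacetime s}
    (h1 : mink ((v + w) + (q - p)) ((v + w) + (q - p)) ≤ 0)
    (h2 : mink (-(v + w) + (q - p)) (-(v + w) + (q - p)) ≤ 0) :
    SpacelikeSeparated (doubleCone (p - v) (p + v)) (doubleCone (q - w) (q + w)) := by
  refine spacelikeSeparated_doubleCone (fun h => absurd h.2 h1.not_gt)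
    (fun h => absurd h.2 (le_of_eq_of_le ?_ h2).not_gt)
  rw [show v + w - (q - p) = -(-(v + w) + (q - p)) by abel, mink_neg_left, mink_neg_right, neg_neg]

/-- The double cone with centre `p` and half-axis `v`, as a bounded region. -/
def centeredCone (p v : Spacetime s) : Region s where
  carrier := doubleCone (p - v) (p + v)
  isOpen := (isOpen_forwardCone.preimage (continuous_id.sub continuous_const)).inter
    (isOpen_forwardCone.preimage (continuous_const.sub continuous_id))
  isBounded := by
    refine (Metric.isBounded_closedBall (x := p) (r := v 0)).subset fun x hx => ?_
    rw [mem_closedBall_iff_norm]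
    refine norm_le_of_mem (forwardCone_subset ?_) (forwardCone_subset ?_)
    · convert hx.1 using 1; abel
    · convert hx.2 using 1; abel

theorem centeredCone_carrier (p v : Spacetime s) :
    (centeredCone p v).carrier = doubleCone (p - v) (p + v) := rfl

theorem mem_centeredCone {p v x : Spacetime s} : x ∈ (centeredCone p v).carrier ↔
    v + (x - p) ∈ forwardCone s ∧ v - (x - p) ∈ forwardCone s := by
  rw [show v + (x - p) = x - (p - v) by abel, show v - (x - p) = p + v - x by abel]
  exact Iff.rfl

theorem centeredCone_nonempty (p : Spacetime s) {v : Spacetime s} (hv : v ∈ forwardCone s) :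
    (centeredCone p v).carrier.Nonempty :=
  ⟨p, mem_centeredCone.mpr (by simpa using hv)⟩

theorem centeredCone_subset_ball (p v : Spacetime s) :
    (centeredCone p v).carrier ⊆ Metric.closedBall p (v 0) := by
  intro x hx
  rw [mem_closedBall_iff_norm]
  rw [mem_centeredCone] at hx
  exact norm_le_of_mem (forwardCone_subset hx.1) (forwardCone_subset hx.2)

theorem Region.ext_carrier {O P : Region s} (h : O.carrier = P.carrier) : O = P := by
  cases O; cases P; cases h; rfl

theorem centeredCone_translate (p v c : Spacetime s) :
    (centeredCone p v).translate c = centeredCone (p + c) v := by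
  apply Region.ext_carrier
  ext x
  change x - c ∈ (centeredCone p v).carrier ↔ _
  rw [mem_centeredCone, mem_centeredCone, sub_sub, add_comm c p]

theorem doubleCone_eq_centeredCone (a b : Spacetime s) :
    doubleCone a b = (centeredCone ((2⁻¹ : ℝ) • (a + b)) ((2⁻¹ : ℝ) • (b - a))).carrier := by
  rw [centeredCone_carrier]
  congr 1 <;> module

/-- If `m` is spacelike, then `z + B m` is not timelike for large `B`. -/
theorem eventually_mink_add_smul_nonpos {m : Spacetime s} (hm : mink m m < 0) (z : Spacetime s) :
    ∀ᶠ B : ℝ in Filter.atTop, mink (z + B • m) (z + B • m) ≤ 0 := by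
  have h : ∀ B : ℝ, mink (z + B • m) (z + B • m) =
      mink z z + B * (2 * mink z m + B * mink m m) := by
    intro B
    simp only [mink_add_left, mink_add_right, mink_smul_left, mink_smul_right, mink_comm m z]
    ring
  filter_upwards [Filter.eventually_ge_atTop 1,
    Filter.eventually_ge_atTop ((|mink z z| + 2 * |mink z m|) / (-mink m m))] with B h1 h2
  rw [h]
  rw [div_le_iff₀ (by linarith)] at h2
  have h3 := le_abs_self (mink z m)
  have h4 := le_abs_self (mink z z)
  have h5 := abs_nonneg (mink z z)
  nlinarith

/-- In at least two space dimensions there is a spatial vector orthogonal to a given vector. -/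
theorem exists_spatial_orthogonal (hs : 2 ≤ s) (e : Spacetime s) :
    ∃ m : Fin s → ℝ, m ≠ 0 ∧ ∑ i, e i.succ * m i = 0 := by
  let f : (Fin s → ℝ) →ₗ[ℝ] ℝ := Fintype.linearCombination ℝ (fun i => e i.succ)
  have : LinearMap.ker f ≠ ⊥ := LinearMap.ker_ne_bot_of_finrank_lt (by simp; omega)
  obtain ⟨m, hm, h0⟩ := Submodule.exists_mem_ne_zero_of_ne_bot this
  refine ⟨m, h0, ?_⟩
  simpa [f, Fintype.linearCombination_apply, mul_comm] using hm

theorem mink_spatial_right (x : Spacetime s) (m : Fin s → ℝ) :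
    mink x (spatial m) = -∑ i, x i.succ * m i := by simp [mink]

end Geometry

/-! ### Positive-energy functions of one variable -/

section PositiveEnergy

open MeasureTheory

/-- A function on `ℝ` which is the Fourier transform of a complex combination of finite measures
on `[0, ∞)`; it plays the part of a bounded function with an analytic continuation to the upper
half plane. -/
def IsPositiveEnergy (g : ℝ → ℂ) : Prop :=
  ∃ m : Fin 4 → Measure ℝ, (∀ k, IsFiniteMeasure (m k)) ∧ (∀ k, m k (Set.Iio 0) = 0) ∧
    ∀ t, g t = (charFun (m 0) t - charFun (m 1) t + Complex.I * charFun (m 2) t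
      - Complex.I * charFun (m 3) t) / 4

theorem charFun_eq_of_restrict (m : Measure ℝ) [IsFiniteMeasure m] (hm : m (Set.Iio 0) = 0)
    (t : ℝ) : charFun m t = (m.real (Set.Iic 0) : ℂ) +
      ∫ x in Set.Ioi 0, Complex.exp (t * x * Complex.I) ∂m := by
  have hint : Integrable (fun x : ℝ => Complex.exp (t * x * Complex.I)) m := by
    refine Integrable.of_bound (by fun_prop) 1 (Filter.Eventually.of_forall fun x => ?_)
    rw [← Complex.ofReal_mul, Complex.norm_exp_ofReal_mul_I]
  rw [charFun_apply_real, ← integral_add_compl (s := Set.Iic (0 : ℝ)) measurableSet_Iic hint,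
    Set.compl_Iic]
  congr 1
  have hae : ∀ᵐ x ∂m, ¬ x ∈ Set.Iio (0 : ℝ) := by
    rw [ae_iff]; simpa [Set.Iio] using hm
  have : ∫ x in Set.Iic (0 : ℝ), Complex.exp (t * x * Complex.I) ∂m
      = ∫ _x in Set.Iic (0 : ℝ), (1 : ℂ) ∂m := by
    refine setIntegral_congr_ae measurableSet_Iic ?_
    filter_upwards [hae] with x hx hx'
    have : x = 0 := le_antisymm hx' (not_lt.mp hx)
    simp [this]
  rw [this]
  simp

theorem charFun_sub_eq_const {m n : Measure ℝ} [IsFiniteMeasure m] [IsFiniteMeasure n]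
    (hm : m (Set.Iio 0) = 0) (hn : n (Set.Iio 0) = 0)
    (h : m.restrict (Set.Ioi 0) = n.restrict (Set.Ioi 0)) (t : ℝ) :
    charFun m t - charFun n t = charFun m 0 - charFun n 0 := by
  simp only [charFun_eq_of_restrict m hm, charFun_eq_of_restrict n hn, h]
  ring

/-- If the Fourier transform of a signed measure on `[0, ∞)` is also that of one on `(-∞, 0]`, the
two measures agree, so that only the atom at `0` contributes. -/
theorem charFun_sub_eq_const_of_reflect {m n m' n' : Measure ℝ} [IsFiniteMeasure m]
    [IsFiniteMeasure n] [IsFiniteMeasure m'] [IsFiniteMeasure n']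
    (hm : m (Set.Iio 0) = 0) (hn : n (Set.Iio 0) = 0)
    (hm' : m' (Set.Iio 0) = 0) (hn' : n' (Set.Iio 0) = 0)
    (h : ∀ t, charFun m t - charFun n t = charFun m' (-t) - charFun n' (-t)) (t : ℝ) :
    charFun m t - charFun n t = charFun m 0 - charFun n 0 := by
  apply charFun_sub_eq_const hm hn
  have hmap : ∀ (ν : Measure ℝ) (t : ℝ),
      charFun (ν.map (fun x => (-1) * x)) t = charFun ν (-t) := by
    intro ν t
    have := charFun_map_mul (μ := ν) (-1) t
    rwa [neg_one_mul] at this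
  have hrefl : ∀ ν : Measure ℝ, ν (Set.Iio 0) = 0 →
      (ν.map (fun x => (-1) * x)).restrict (Set.Ioi 0) = 0 := by
    intro ν hν
    rw [Measure.restrict_eq_zero, Measure.map_apply (by fun_prop) measurableSet_Ioi]
    convert hν using 2
    ext x; simp
  have hsum : m + n'.map (fun x => (-1) * x) = n + m'.map (fun x => (-1) * x) := by
    apply Measure.ext_of_charFun
    funext t
    have hadd : ∀ (μ ν : Measure ℝ) [IsFiniteMeasure μ] [IsFiniteMeasure ν],
        charFun (μ + ν) t = charFun μ t + charFun ν t := by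
      intro μ ν _ _
      have hint : ∀ (μ : Measure ℝ) [IsFiniteMeasure μ],
          Integrable (fun x : ℝ => Complex.exp (t * x * Complex.I)) μ := fun μ _ => by
        refine Integrable.of_bound (by fun_prop) 1 (Filter.Eventually.of_forall fun x => ?_)
        rw [← Complex.ofReal_mul, Complex.norm_exp_ofReal_mul_I]
      simp only [charFun_apply_real]
      exact integral_add_measure (hint μ) (hint ν)
    rw [hadd, hadd, hmap, hmap]
    linear_combination h t
  have := congrArg (fun ν => ν.restrict (Set.Ioi (0 : ℝ))) hsum
  simpa only [Measure.restrict_add, hrefl _ hm', hrefl _ hn', add_zero] using this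

/-- The substitute for Liouville's theorem: a function of positive energy whose reflection is also
of positive energy is constant. -/
theorem IsPositiveEnergy.eq_const {f g : ℝ → ℂ} (hf : IsPositiveEnergy f)
    (hg : IsPositiveEnergy g) (h : ∀ t, f t = g (-t)) (t : ℝ) : f t = f 0 := by
  obtain ⟨m, hm, hm0, hf⟩ := hf
  obtain ⟨n, hn, hn0, hg⟩ := hg
  have h1 : ∀ t, charFun (m 0) t - charFun (m 1) t + Complex.I * charFun (m 2) t
      - Complex.I * charFun (m 3) t = charFun (n 0) (-t) - charFun (n 1) (-t)
        + Complex.I * charFun (n 2) (-t) - Complex.I * charFun (n 3) (-t) := by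
    intro t
    have := h t
    rw [hf, hg] at this
    linear_combination 4 * this
  -- conjugating the equation at `-t` changes the sign of the `I` terms only
  have h2 : ∀ t, charFun (m 0) t - charFun (m 1) t - Complex.I * charFun (m 2) t
      + Complex.I * charFun (m 3) t = charFun (n 0) (-t) - charFun (n 1) (-t)
        - Complex.I * charFun (n 2) (-t) + Complex.I * charFun (n 3) (-t) := by
    intro t
    have := congrArg (starRingEnd ℂ) (h1 (-t))
    simp only [map_sub, map_add, map_mul, charFun_neg, Complex.conj_I, Complex.conj_conj] at this
    simp only [charFun_neg]
    linear_combination this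
  have e1 := charFun_sub_eq_const_of_reflect (hm0 0) (hm0 1) (hn0 0) (hn0 1)
    (fun t => by linear_combination (h1 t + h2 t) / 2) t
  have e2 := charFun_sub_eq_const_of_reflect (hm0 2) (hm0 3) (hn0 2) (hn0 3)
    (fun t => by
      have hI := Complex.I_mul_I
      linear_combination (-Complex.I / 2) * (h1 t - h2 t)
        + (charFun (m 2) t - charFun (m 3) t - charFun (n 2) (-t) + charFun (n 3) (-t)) * hI) t
  rw [hf, hf]
  linear_combination (e1 + Complex.I * e2) / 4

end PositiveEnergy

/-! ### Translations with positive energy -/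

section Translations

open MeasureTheory

variable {s : ℕ} {H : Type*} [NormedAddCommGroup H] [InnerProductSpace ℂ H] [CompleteSpace H]
  {U : TranslationRep s H}

theorem TranslationRep.op_add (U : TranslationRep s H) (a b : Spacetime s) :
    U.op (a + b) = U.op a * U.op b := by
  simp [TranslationRep.op, U.map_add]

theorem TranslationRep.op_zero (U : TranslationRep s H) : U.op 0 = 1 := by
  have h := U.map_add 0 0
  rw [add_zero, left_eq_mul] at h
  simp [TranslationRep.op, h]

theorem TranslationRep.op_mul_op_neg (U : TranslationRep s H) (a : Spacetime s) :
    U.op a * U.op (-a) = 1 := by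
  rw [← U.op_add, add_neg_cancel, U.op_zero]

theorem TranslationRep.op_neg_mul_op (U : TranslationRep s H) (a : Spacetime s) :
    U.op (-a) * U.op a = 1 := by
  rw [← U.op_add, neg_add_cancel, U.op_zero]

theorem TranslationRep.star_op (U : TranslationRep s H) (a : Spacetime s) :
    star (U.op a) = U.op (-a) := by
  have h : star (U.op a) * U.op a = 1 := Unitary.coe_star_mul_self (U.U a)
  calc star (U.op a) = star (U.op a) * (U.op a * U.op (-a)) := by rw [U.op_mul_op_neg, mul_one]
    _ = U.op (-a) := by rw [← mul_assoc, h, one_mul]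

theorem inner_star_left (A : H →L[ℂ] H) (x y : H) : ⟪star A x, y⟫_ℂ = ⟪x, A y⟫_ℂ := by
  rw [ContinuousLinearMap.star_eq_adjoint, ContinuousLinearMap.adjoint_inner_left]

theorem inner_star_right (A : H →L[ℂ] H) (x y : H) : ⟪x, star A y⟫_ℂ = ⟪A x, y⟫_ℂ := by
  rw [ContinuousLinearMap.star_eq_adjoint, ContinuousLinearMap.adjoint_inner_right]

theorem TranslationRep.inner_op_left (U : TranslationRep s H) (a : Spacetime s) (x y : H) :
    ⟪U.op a x, y⟫_ℂ = ⟪x, U.op (-a) y⟫_ℂ := by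
  rw [← U.star_op, inner_star_right]

/-- Under the spectrum condition, matrix elements of translations in a causal future-directed
direction have positive energy. -/
theorem SpectrumCondition.isPositiveEnergy (hB : SpectrumCondition U) {e : Spacetime s}
    (he : e ∈ closedForwardCone s) (x y : H) :
    IsPositiveEnergy fun t => ⟪x, U.op (t • e) y⟫_ℂ := by
  have key : ∀ ψ : H, ∃ m : Measure ℝ, IsFiniteMeasure m ∧ m (Set.Iio 0) = 0 ∧
      ∀ t : ℝ, ⟪ψ, U.op (t • e) ψ⟫_ℂ = charFun m t := by
    intro ψ
    obtain ⟨μ, hμ, h1, h2⟩ := hB ψ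
    have hc : Continuous fun p : Spacetime s => mink p e :=
      continuous_mink continuous_id continuous_const
    refine ⟨μ.map fun p => mink p e, inferInstance, ?_, fun t => ?_⟩
    · rw [Measure.map_apply hc.measurable measurableSet_Iio]
      refine measure_mono_null (t := (closedForwardCone s)ᶜ) ?_ h2
      exact fun p hp hp' => absurd (mink_nonneg hp' he) (not_le.mpr hp)
    · rw [h1, charFun_apply_real, integral_map hc.measurable.aemeasurable (by fun_prop)]
      congr 1; funext p
      rw [mink_smul_right]; push_cast; ring_nf
  choose m hm hm0 hmt using key
  refine ⟨![m (y + x), m (y - x), m (y + Complex.I • x), m (y - Complex.I • x)],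
    ?_, ?_, fun t => ?_⟩
  · intro k; fin_cases k <;> exact hm _
  · intro k; fin_cases k <;> exact hm0 _
  · have h := inner_map_polarization (U.op (-(t • e)) : H →ₗ[ℂ] H) y x
    simp only [ContinuousLinearMap.coe_coe, U.inner_op_left, neg_neg, hmt] at h
    exact h

/-- The spectral measure of a vector invariant under the translations along `e` is carried by the
momenta `p` with `p · e = 0`; the vector is therefore invariant under any translation `x` that is
orthogonal to all such `p` in the closed forward cone. -/
theorem SpectrumCondition.op_apply_eq_self (hB : SpectrumCondition U) {e x : Spacetime s}
    (hx : ∀ p ∈ closedForwardCone s, mink p e = 0 → mink p x = 0) {ψ : H}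
    (hψ : ∀ t : ℝ, U.op (t • e) ψ = ψ) : U.op x ψ = ψ := by
  obtain ⟨μ, hμ, h1, h2⟩ := hB ψ
  have hcone : ∀ᵐ p ∂μ, p ∈ closedForwardCone s := by rw [ae_iff]; exact h2
  have hμ0 : ⟪ψ, ψ⟫_ℂ = (μ.real Set.univ : ℂ) := by
    have := h1 0
    rw [U.op_zero] at this
    simpa [mink] using this
  have hcont : ∀ a : Spacetime s, Continuous fun p : Spacetime s => mink p a := fun a =>
    continuous_mink continuous_id continuous_const
  -- the nonnegative function `1 - cos (t p·e)` has integral zero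
  have hcos : ∀ t : ℝ, ∀ᵐ p ∂μ, Real.cos (t * mink p e) = 1 := by
    intro t
    have hint : Integrable (fun p => Complex.exp (Complex.I * (mink p (t • e) : ℂ))) μ := by
      have := hcont (t • e)
      refine Integrable.of_bound (by fun_prop) 1 (Filter.Eventually.of_forall fun p => ?_)
      rw [mul_comm, Complex.norm_exp_ofReal_mul_I]
    have hre := congrArg RCLike.re (h1 (t • e))
    rw [hψ, hμ0, ← integral_re hint] at hre
    have hre' : μ.real Set.univ = ∫ p, Real.cos (t * mink p e) ∂μ := by
      refine ((Complex.ofReal_re _).symm.trans hre).trans (integral_congr_ae ?_)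
      refine Filter.Eventually.of_forall fun p => ?_
      change (Complex.exp (Complex.I * (mink p (t • e) : ℂ))).re = _
      rw [mul_comm, mink_smul_right]
      exact Complex.exp_ofReal_mul_I_re _
    have hintc : Integrable (fun p => Real.cos (t * mink p e)) μ := by
      have := hcont e
      refine Integrable.of_bound (by fun_prop) 1 (Filter.Eventually.of_forall fun p => ?_)
      exact Real.abs_cos_le_one _
    have hzero : ∫ p, (1 - Real.cos (t * mink p e)) ∂μ = 0 := by
      rw [integral_sub (integrable_const 1) hintc, ← hre']; simp
    rw [integral_eq_zero_iff_of_nonneg (fun p => sub_nonneg.mpr (Real.cos_le_one _))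
      ((integrable_const 1).sub hintc)] at hzero
    filter_upwards [hzero] with p hp
    have hp' : 1 - Real.cos (t * mink p e) = 0 := hp
    linarith
  have hall : ∀ᵐ p ∂μ, ∀ n : ℕ, Real.cos ((1 / ((n : ℝ) + 1)) * mink p e) = 1 :=
    ae_all_iff.mpr fun n => hcos _
  have hpe : ∀ᵐ p ∂μ, mink p e = 0 := by
    filter_upwards [hall] with p hp
    obtain ⟨n, hn⟩ := exists_nat_gt |mink p e|
    have hn1 : (0 : ℝ) < (n : ℝ) + 1 := by positivity
    have hsmall : |(1 / ((n : ℝ) + 1)) * mink p e| < 1 := by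
      rw [abs_mul, abs_of_pos (by positivity), one_div, inv_mul_lt_iff₀ hn1]; linarith
    have hsmall := abs_lt.mp hsmall
    have := (Real.cos_eq_one_iff_of_lt_of_lt (by linarith [Real.pi_gt_three])
      (by linarith [Real.pi_gt_three])).mp (hp n)
    rcases mul_eq_zero.mp this with h | h
    · exact absurd h (by positivity)
    · exact h
  have hinner : ⟪ψ, U.op x ψ⟫_ℂ = ⟪ψ, ψ⟫_ℂ := by
    rw [h1, hμ0]
    have : (fun p => Complex.exp (Complex.I * (mink p x : ℂ))) =ᵐ[μ] fun _ => 1 := by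
      filter_upwards [hcone, hpe] with p hp hp'
      simp [hx p hp hp']
    rw [integral_congr_ae this]
    simp
  -- equality in the Cauchy–Schwarz inequality
  have hnorm : ⟪U.op x ψ, U.op x ψ⟫_ℂ = ⟪ψ, ψ⟫_ℂ := by
    rw [U.inner_op_left, ← mul_apply_eq_comp, U.op_neg_mul_op]; rfl
  have hconj : ⟪U.op x ψ, ψ⟫_ℂ = ⟪ψ, ψ⟫_ℂ := by
    rw [← inner_conj_symm, hinner, inner_self_conj]
  rw [← sub_eq_zero, ← inner_self_eq_zero (𝕜 := ℂ), inner_sub_left, inner_sub_right,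
    inner_sub_right, hnorm, hinner, hconj]
  ring

theorem SpectrumCondition.op_apply_eq_self_of_time (hB : SpectrumCondition U) {ψ : H}
    (hψ : ∀ t : ℝ, U.op (t • timeUnit s) ψ = ψ) (x : Spacetime s) : U.op x ψ = ψ := by
  refine hB.op_apply_eq_self (fun p hp h0 => ?_) hψ
  rw [mink_timeUnit_right] at h0
  have : p = 0 := by
    by_contra hne
    exact (closedForwardCone_pos hp hne).ne' h0
  simp [this, mink]

/-- A momentum in the closed forward cone orthogonal to a causal vector `e ≠ 0` is a multiple of
`e`, hence orthogonal to the spatial vectors orthogonal to `e`. -/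
theorem mink_spatial_eq_zero {e p : Spacetime s} (he : e ∈ closedForwardCone s) (he0 : e ≠ 0)
    (hp : p ∈ closedForwardCone s) (h : mink p e = 0) {m : Fin s → ℝ}
    (hm : ∑ i, e i.succ * m i = 0) : mink p (spatial m) = 0 := by
  have hpos := closedForwardCone_pos he he0
  have hz : ∑ i : Fin s, (e 0 * p i.succ - p 0 * e i.succ) ^ 2 ≤ 0 := by
    have h1 := hp.2
    have h2 := he.2
    simp only [mink] at h h1 h2
    have : ∑ i : Fin s, (e 0 * p i.succ - p 0 * e i.succ) ^ 2
        = e 0 ^ 2 * ∑ i : Fin s, p i.succ * p i.succ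
          - 2 * e 0 * p 0 * ∑ i : Fin s, p i.succ * e i.succ
          + p 0 ^ 2 * ∑ i : Fin s, e i.succ * e i.succ := by
      simp only [Finset.mul_sum, ← Finset.sum_sub_distrib, ← Finset.sum_add_distrib]
      exact Finset.sum_congr rfl fun i _ => by ring
    rw [this]
    rw [← sub_eq_zero.mp h]
    nlinarith [mul_nonneg (sq_nonneg (e 0)) h1, mul_nonneg (sq_nonneg (p 0)) h2]
  have hz' : ∀ i : Fin s, e 0 * p i.succ = p 0 * e i.succ := by
    intro i
    have h3 := Finset.single_le_sum
      (f := fun i : Fin s => (e 0 * p i.succ - p 0 * e i.succ) ^ 2)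
      (fun i _ => sq_nonneg _) (Finset.mem_univ i)
    have h4 := pow_eq_zero_iff two_ne_zero |>.mp (le_antisymm (h3.trans hz) (sq_nonneg _))
    linarith
  have h5 : e 0 * ∑ i : Fin s, p i.succ * m i = p 0 * ∑ i : Fin s, e i.succ * m i := by
    rw [Finset.mul_sum, Finset.mul_sum]
    refine Finset.sum_congr rfl fun i _ => ?_
    rw [← mul_assoc, ← mul_assoc, hz' i]
  rw [hm, mul_zero, mul_eq_zero] at h5
  rw [mink_spatial_right, h5.resolve_left hpos.ne', neg_zero]

end Translations

/-! ### Commutativity along causal lines -/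

section Vacuum

variable {s : ℕ} {H : Type*} [NormedAddCommGroup H] [InnerProductSpace ℂ H] [CompleteSpace H]
  {𝒜 : LocalNet s H} {U : TranslationRep s H} {Ω : H}

theorem TranslationCovariant.conj_mem (hA : TranslationCovariant 𝒜 U) {O : Region s}
    {A : H →L[ℂ] H} (h : A ∈ 𝒜.alg O) (a : Spacetime s) :
    U.op a * A * U.op (-a) ∈ 𝒜.alg (O.translate a) := by
  have : U.op a * A * U.op (-a) ∈ (𝒜.alg (O.translate a) : Set (H →L[ℂ] H)) := by
    rw [← hA O a]; exact ⟨A, h, rfl⟩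
  exact this

theorem TranslationCovariant.exists_eq_conj (hA : TranslationCovariant 𝒜 U) {O : Region s}
    {a : Spacetime s} {B : H →L[ℂ] H} (h : B ∈ 𝒜.alg (O.translate a)) :
    ∃ A ∈ 𝒜.alg O, U.op a * A * U.op (-a) = B := by
  have h' : B ∈ (𝒜.alg (O.translate a) : Set (H →L[ℂ] H)) := h
  rw [← hA O a] at h'
  exact h'

theorem TranslationRep.op_eq_one {a : Spacetime s} (h : ∀ ψ, U.op a ψ = ψ) : U.op a = 1 :=
  ContinuousLinearMap.ext h

theorem TranslationCovariant.alg_translate_eq (hA : TranslationCovariant 𝒜 U) (O : Region s)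
    {a : Spacetime s} (h : ∀ ψ, U.op a ψ = ψ) : 𝒜.alg (O.translate a) = 𝒜.alg O := by
  have h1 := TranslationRep.op_eq_one h
  have h2 : U.op (-a) = 1 := by
    have := U.op_mul_op_neg a
    rwa [h1, one_mul] at this
  apply SetLike.coe_injective
  rw [← hA O a]
  simp [h1, h2]

/-- If `A` commutes with all translates of `B` along a causal line, the corresponding vacuum
expectation value is constant along it: `⟨Ω, A B(t) Ω⟩` and `⟨Ω, B(t) A Ω⟩` are of positive
energy in `t` and in `-t`, respectively. -/
theorem inner_op_eq_of_commute (hB : SpectrumCondition U) (hΩ : Ω ∈ U.invariants)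
    {e : Spacetime s} (he : e ∈ closedForwardCone s) {A B : H →L[ℂ] H}
    (h : ∀ t : ℝ, A * (U.op (t • e) * B * U.op (-(t • e)))
      = (U.op (t • e) * B * U.op (-(t • e))) * A) (t : ℝ) :
    ⟪star A Ω, U.op (t • e) (B Ω)⟫_ℂ = ⟪star A Ω, B Ω⟫_ℂ := by
  have hΩ' : ∀ a, U.op a Ω = Ω := hΩ
  have key := (hB.isPositiveEnergy he (star A Ω) (B Ω)).eq_const
    (hB.isPositiveEnergy he (star B Ω) (A Ω)) (fun t => by
      have h1 := congrArg (fun T : H →L[ℂ] H => ⟪Ω, T Ω⟫_ℂ) (h t)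
      simp only [mul_apply_eq_comp, hΩ'] at h1
      change ⟪star A Ω, U.op (t • e) (B Ω)⟫_ℂ = ⟪star B Ω, U.op (-t • e) (A Ω)⟫_ℂ
      rw [inner_star_left, inner_star_left, h1, neg_smul]
      nth_rewrite 1 [← hΩ' (t • e)]
      rw [U.inner_op_left, ← mul_apply_eq_comp, U.op_neg_mul_op, one_apply_eq_self]) t
  simpa [U.op_zero] using key

theorem Cyclic.dense_star {𝓜 : StarSubalgebra ℂ (H →L[ℂ] H)} (h : Cyclic 𝓜 Ω) :
    Dense {ψ : H | ∃ A ∈ 𝓜, star A Ω = ψ} := by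
  suffices this : {ψ : H | ∃ A ∈ 𝓜, star A Ω = ψ} = {ψ : H | ∃ A ∈ 𝓜, A Ω = ψ} by
    rw [this]; exact h
  ext ψ
  constructor
  · rintro ⟨A, hA, rfl⟩
    exact ⟨star A, star_mem hA, rfl⟩
  · rintro ⟨A, hA, rfl⟩
    exact ⟨star A, star_mem hA, by rw [star_star]⟩

/-- If the observables of `O` commute with those of all translates of `P` along a causal line, then
the translations along this line act trivially. -/
theorem op_eq_self_of_commute (hA : TranslationCovariant 𝒜 U) (hB : SpectrumCondition U)
    (hΩ : Ω ∈ U.invariants) (hD : ReehSchlieder 𝒜 Ω) {O P : Region s}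
    (hO : O.carrier.Nonempty) (hP : P.carrier.Nonempty) {e : Spacetime s}
    (he : e ∈ closedForwardCone s)
    (h : ∀ t : ℝ, ∀ A ∈ 𝒜.alg O, ∀ B ∈ 𝒜.alg (P.translate (t • e)), A * B = B * A)
    (t : ℝ) (ψ : H) : U.op (t • e) ψ = ψ := by
  have h1 : ∀ A ∈ 𝒜.alg O, ∀ B ∈ 𝒜.alg P,
      ⟪star A Ω, U.op (t • e) (B Ω)⟫_ℂ = ⟪star A Ω, B Ω⟫_ℂ := fun A hAO B hBP =>
    inner_op_eq_of_commute hB hΩ he (fun t => h t A hAO _ (hA.conj_mem hBP _)) t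
  have h2 : ∀ B ∈ 𝒜.alg P, U.op (t • e) (B Ω) = B Ω := by
    intro B hBP
    refine ext_inner_left ℂ fun v => ?_
    refine congrFun (Continuous.ext_on (f := fun v : H => ⟪v, U.op (t • e) (B Ω)⟫_ℂ)
      (g := fun v : H => ⟪v, B Ω⟫_ℂ) (hD O hO).dense_star (by fun_prop) (by fun_prop) ?_) v
    rintro _ ⟨A, hAO, rfl⟩
    exact h1 A hAO B hBP
  refine congrFun (Continuous.ext_on (hD P hP) (by fun_prop) continuous_id ?_) ψ
  rintro _ ⟨B, hBP, rfl⟩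
  exact h2 B hBP

theorem not_forall_op_time_eq_self (hH : ¬ FiniteDimensional ℂ H) (hB : SpectrumCondition U)
    (hC : IsVacuum 𝒜 U Ω) : ¬ ∀ (t : ℝ) (ψ : H), U.op (t • timeUnit s) ψ = ψ := by
  intro h
  have htop : U.invariants = ⊤ := by
    rw [eq_top_iff]
    intro ψ _ a
    exact hB.op_apply_eq_self_of_time (fun t => h t ψ) a
  have hfin := hC.finrank_invariants
  rw [htop, finrank_top] at hfin
  exact hH (Module.finite_of_finrank_eq_succ hfin)

/-- Double cones become spacelike separated when one is moved far away in a spacelike direction. -/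
theorem exists_spacelikeSeparated {x : Spacetime s} (hx : mink x x < 0) (p v q w : Spacetime s) :
    ∃ n : ℕ, SpacelikeSeparated (centeredCone p v).carrier
      (centeredCone (q + (n : ℝ) • x) w).carrier := by
  have h1 := eventually_mink_add_smul_nonpos hx ((v + w) + (q - p))
  have h2 := eventually_mink_add_smul_nonpos hx (-(v + w) + (q - p))
  obtain ⟨n, h1, h2⟩ := (tendsto_natCast_atTop_atTop.eventually (h1.and h2)).exists
  rw [add_assoc, sub_add_eq_add_sub] at h1 h2
  exact ⟨n, spacelikeSeparated_of_mink_nonpos h1 h2⟩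

/-- A spacelike translation acts nontrivially: otherwise locality would make the net commutative. -/
theorem not_forall_op_eq_self_of_spacelike (hH : ¬ FiniteDimensional ℂ H)
    (hA : TranslationCovariant 𝒜 U) (hB : SpectrumCondition U) (hC : IsVacuum 𝒜 U Ω)
    (hD : ReehSchlieder 𝒜 Ω)
    {x : Spacetime s} (hx : mink x x < 0) : ¬ ∀ ψ : H, U.op x ψ = ψ := by
  intro h
  have hn : ∀ (n : ℕ) (ψ : H), U.op ((n : ℝ) • x) ψ = ψ := by
    intro n
    induction n with
    | zero => intro ψ; simp [U.op_zero]
    | succ n ih =>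
      intro ψ
      rw [Nat.cast_succ, add_smul, one_smul, U.op_add, mul_apply_eq_comp, h, ih]
  have hne := centeredCone_nonempty (0 : Spacetime s) timeUnit_mem
  refine not_forall_op_time_eq_self hH hB hC
    (op_eq_self_of_commute hA hB hC.mem_invariants hD hne hne
      (forwardCone_subset timeUnit_mem) fun t A hAO B hBP => ?_)
  obtain ⟨n, hsp⟩ := exists_spacelikeSeparated hx 0 (timeUnit s) (0 + t • timeUnit s) (timeUnit s)
  refine 𝒜.locality _ _ hsp A hAO B ?_
  rw [← centeredCone_translate, hA.alg_translate_eq _ (hn n), ← centeredCone_translate]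
  exact hBP

/-- The observables of a nonempty region do not commute with those of all translates of another
along a causal line. Locality enters only through the spatial directions orthogonal to the line. -/
theorem not_forall_commute_along_causal_line (hs : 2 ≤ s) (hH : ¬ FiniteDimensional ℂ H)
    (hA : TranslationCovariant 𝒜 U) (hB : SpectrumCondition U) (hC : IsVacuum 𝒜 U Ω)
    (hD : ReehSchlieder 𝒜 Ω) {O P : Region s}
    (hO : O.carrier.Nonempty) (hP : P.carrier.Nonempty) {e : Spacetime s}
    (he : e ∈ closedForwardCone s) (he0 : e ≠ 0) :
    ¬ ∀ t : ℝ, ∀ A ∈ 𝒜.alg O, ∀ B ∈ 𝒜.alg (P.translate (t • e)), A * B = B * A := by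
  intro h
  have hU := op_eq_self_of_commute hA hB hC.mem_invariants hD hO hP he h
  obtain ⟨m, hm0, hm⟩ := exists_spatial_orthogonal hs e
  exact not_forall_op_eq_self_of_spacelike hH hA hB hC hD (mink_spatial_neg hm0) fun ψ =>
    hB.op_apply_eq_self (fun p hp hpe => mink_spatial_eq_zero he he0 hp hpe hm) fun t => hU t ψ

/-- The algebra of the empty region consists of scalars only. -/
theorem exists_eq_smul_one_of_empty (hA : TranslationCovariant 𝒜 U) (hB : SpectrumCondition U)
    (hC : IsVacuum 𝒜 U Ω) (hD : ReehSchlieder 𝒜 Ω) {O : Region s} (hO : O.carrier = ∅)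
    {A : H →L[ℂ] H} (hAO : A ∈ 𝒜.alg O) : ∃ c : ℂ, A = c • 1 := by
  have hcomm : ∀ P : Region s, ∀ A ∈ 𝒜.alg O, ∀ B ∈ 𝒜.alg P, A * B = B * A := fun P =>
    𝒜.locality O P fun x hx => by simp [hO] at hx
  set P := centeredCone (0 : Spacetime s) (timeUnit s)
  have hP : P.carrier.Nonempty := centeredCone_nonempty 0 timeUnit_mem
  have hinv : A Ω ∈ U.invariants := by
    refine hB.op_apply_eq_self_of_time fun t => ?_
    have h1 : ∀ B ∈ 𝒜.alg P, ⟪A Ω, U.op (-t • timeUnit s) (B Ω)⟫_ℂ = ⟪A Ω, B Ω⟫_ℂ := by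
      intro B hBP
      have := inner_op_eq_of_commute hB hC.mem_invariants (forwardCone_subset timeUnit_mem)
        (A := star A) (B := B)
        (fun t => hcomm _ _ (star_mem hAO) _ (hA.conj_mem hBP _)) (-t)
      rwa [star_star] at this
    refine ext_inner_right ℂ fun v => ?_
    rw [U.inner_op_left, ← neg_smul]
    refine congrFun (Continuous.ext_on (f := fun v : H => ⟪A Ω, U.op (-t • timeUnit s) v⟫_ℂ)
      (g := fun v : H => ⟪A Ω, v⟫_ℂ) (hD P hP) (by fun_prop) (by fun_prop) ?_) v
    rintro _ ⟨B, hBP, rfl⟩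
    exact h1 B hBP
  have hΩ0 : (⟨Ω, hC.mem_invariants⟩ : U.invariants) ≠ 0 := by
    intro h0
    have h1 : Ω = 0 := congrArg Subtype.val h0
    have h2 := hC.norm_eq_one
    rw [h1, norm_zero] at h2
    exact zero_ne_one h2
  obtain ⟨c, hc⟩ := exists_smul_eq_of_finrank_eq_one hC.finrank_invariants hΩ0 ⟨A Ω, hinv⟩
  have hc' : c • Ω = A Ω := congrArg Subtype.val hc
  refine ⟨c, ContinuousLinearMap.ext fun v => ?_⟩
  refine congrFun (Continuous.ext_on (hD P hP) (by fun_prop) (by fun_prop) ?_) v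
  rintro _ ⟨B, hBP, rfl⟩
  rw [← mul_apply_eq_comp, hcomm P A hAO B hBP, mul_apply_eq_comp, ← hc', map_smul]
  rfl

/-- A shift that is compatible with the net as an inclusion is trivial. -/
theorem eq_zero_of_alg_le (hs : 2 ≤ s) (hH : ¬ FiniteDimensional ℂ H)
    (hA : TranslationCovariant 𝒜 U) (hB : SpectrumCondition U) (hC : IsVacuum 𝒜 U Ω)
    (hD : ReehSchlieder 𝒜 Ω) {z : Spacetime s}
    (h : ∀ p, 𝒜.alg (centeredCone p (timeUnit s)) ≤ 𝒜.alg (centeredCone (p + z) (timeUnit s))) :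
    z = 0 := by
  have hn : ∀ (n : ℕ) (p : Spacetime s), 𝒜.alg (centeredCone p (timeUnit s)) ≤
      𝒜.alg (centeredCone (p + (n : ℝ) • z) (timeUnit s)) := by
    intro n
    induction n with
    | zero => intro p; simp
    | succ n ih =>
      intro p
      refine (ih p).trans ((h _).trans (le_of_eq ?_))
      rw [Nat.cast_succ, add_smul, one_smul, add_assoc]
  have hne := fun p => centeredCone_nonempty (p : Spacetime s) timeUnit_mem
  by_contra hz
  rcases lt_or_ge (mink z z) 0 with hsp | hca
  · refine not_forall_commute_along_causal_line hs hH hA hB hC hD (hne 0) (hne 0)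
      (forwardCone_subset timeUnit_mem) (e := timeUnit s) ?_ fun t A hAO B hBP => ?_
    · intro h0; simpa using congrFun h0 0
    · rw [centeredCone_translate] at hBP
      obtain ⟨n, hn'⟩ := exists_spacelikeSeparated hsp 0 (timeUnit s) (0 + t • timeUnit s)
        (timeUnit s)
      exact 𝒜.locality _ _ hn' A hAO B (hn n _ hBP)
  -- choose `b` far away in a spatial direction orthogonal to `z`
  obtain ⟨m, hm0, hm⟩ := exists_spatial_orthogonal hs z
  have hmm := mink_spatial_neg hm0
  obtain ⟨B, hB0⟩ := (eventually_mink_add_smul_nonpos hmm ((2 + |z 0|) • timeUnit s)).exists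
  have htm : mink (timeUnit s) (spatial m) = 0 := by simp [mink]
  have hzm : mink z (spatial m) = 0 := by rw [mink_spatial_right, hm, neg_zero]
  have hfar : ∀ σ r : ℝ, |σ| = 2 → |r| ≤ 1 →
      mink (σ • timeUnit s + r • z + B • spatial m) (σ • timeUnit s + r • z + B • spatial m)
        ≤ 0 := by
    intro σ r hσ hr
    have h1 : ∀ w : Spacetime s, mink w (spatial m) = 0 →
        mink (w + B • spatial m) (w + B • spatial m)
          = mink w w + B ^ 2 * mink (spatial m) (spatial m) := by
      intro w hw
      simp only [mink_add_left, mink_add_right, mink_smul_left, mink_smul_right,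
        mink_comm (spatial m) w, hw]
      ring
    rw [h1 _ (by rw [mink_smul_left, htm, mul_zero])] at hB0
    rw [h1 _ (by rw [mink_add_left, mink_smul_left, mink_smul_left, htm, hzm]; ring)]
    have h2 := mink_self_le (σ • timeUnit s + r • z)
    have h3 : |(σ • timeUnit s + r • z) 0| ≤ 2 + |z 0| := by
      simp only [Pi.add_apply, Pi.smul_apply, smul_eq_mul, timeUnit_zero, mul_one]
      refine (abs_add_le _ _).trans ?_
      rw [hσ, abs_mul]
      nlinarith [abs_nonneg (z 0)]
    have h4 := mul_self_le_mul_self (abs_nonneg _) h3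
    rw [abs_mul_abs_self] at h4
    rw [mink_smul_left, mink_smul_right, mink_timeUnit_right, timeUnit_zero] at hB0
    linarith
  have hsep : ∀ (p : Spacetime s) (r : ℝ), |r| ≤ 1 →
      SpacelikeSeparated (centeredCone p (timeUnit s)).carrier
        (centeredCone (p + (B • spatial m + r • z)) (timeUnit s)).carrier := by
    intro p r hr
    have e1 : (timeUnit s + timeUnit s) + (p + (B • spatial m + r • z) - p)
      = (2 : ℝ) • timeUnit s + r • z + B • spatial m := by module
    have e2 : -(timeUnit s + timeUnit s) + (p + (B • spatial m + r • z) - p)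
      = (-2 : ℝ) • timeUnit s + r • z + B • spatial m := by module
    apply spacelikeSeparated_of_mink_nonpos
    · rw [e1]; exact hfar 2 r (by norm_num) hr
    · rw [e2]; exact hfar (-2) r (by norm_num) hr
  have hline : ∀ t : ℝ, ∀ A ∈ 𝒜.alg (centeredCone 0 (timeUnit s)),
      ∀ C ∈ 𝒜.alg ((centeredCone (B • spatial m) (timeUnit s)).translate (t • z)),
        A * C = C * A := by
    intro t A hAO C hCP
    rw [centeredCone_translate] at hCP
    have hfr : |Int.fract t| ≤ 1 := by
      rw [abs_of_nonneg (Int.fract_nonneg t)]; exact (Int.fract_lt_one t).le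
    have ht := Int.floor_add_fract t
    -- a whole number of shifts brings the two regions to bounded distance along the line
    rcases le_total 0 ⌊t⌋ with h0 | h0
    · obtain ⟨n, hn'⟩ := Int.eq_ofNat_of_zero_le h0
      rw [hn'] at ht
      refine 𝒜.locality _ _ (hsep (0 + (n : ℝ) • z) _ hfr) A (hn n _ hAO) C ?_
      convert hCP using 2
      have : t • z = (n : ℝ) • z + Int.fract t • z := by
        rw [← add_smul]; exact congrArg (· • z) ht.symm
      rw [this]; congr 1; abel
    · obtain ⟨n, hn'⟩ := Int.eq_ofNat_of_zero_le (neg_nonneg.mpr h0)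
      have hn'' : (⌊t⌋ : ℝ) = -(n : ℝ) := by
        have : ⌊t⌋ = -(n : ℤ) := by omega
        rw [this]; push_cast; rfl
      rw [hn''] at ht
      refine 𝒜.locality _ _ (hsep 0 _ hfr) A hAO C ?_
      convert hn n _ hCP using 2
      have : t • z = -(n : ℝ) • z + Int.fract t • z := by rw [← add_smul, ht]
      rw [this]; congr 1; module
  rcases le_total 0 (z 0) with h0 | h0
  · exact not_forall_commute_along_causal_line hs hH hA hB hC hD (hne 0) (hne _) ⟨h0, hca⟩ hz
      hline
  · refine not_forall_commute_along_causal_line hs hH hA hB hC hD (hne 0) (hne (B • spatial m))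
      (e := -z) ⟨by simpa using h0, by rw [mink_neg_left, mink_neg_right]; simpa using hca⟩
      (neg_ne_zero.mpr hz) fun t => ?_
    rw [smul_neg, ← neg_smul]
    exact hline (-t)

/-- The translation group acts faithfully. -/
theorem eq_zero_of_op_eq_one (hs : 2 ≤ s) (hH : ¬ FiniteDimensional ℂ H)
    (hA : TranslationCovariant 𝒜 U) (hB : SpectrumCondition U) (hC : IsVacuum 𝒜 U Ω)
    (hD : ReehSchlieder 𝒜 Ω) {z : Spacetime s} (h : U.op z = 1) : z = 0 := by
  refine eq_zero_of_alg_le hs hH hA hB hC hD fun p => le_of_eq ?_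
  rw [← centeredCone_translate, hA.alg_translate_eq _ fun ψ => by rw [h]; rfl]

end Vacuum

/-! ### Additive causal automorphisms -/

section CausalAutomorphism

variable {s : ℕ}

theorem mem_or_neg_mem_forwardCone {x : Spacetime s} (hx : 0 < mink x x) :
    x ∈ forwardCone s ∨ -x ∈ forwardCone s := by
  have h := mink_self_le x
  rcases lt_trichotomy (x 0) 0 with h0 | h0 | h0
  · exact Or.inr ⟨by simpa using h0, by rwa [mink_neg_left, mink_neg_right, neg_neg]⟩
  · rw [h0] at h; linarith
  · exact Or.inl ⟨h0, hx⟩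

/-- Two future-directed vectors that are not proportional have a spacelike difference with positive
integer coefficients. -/
theorem exists_nat_smul_sub_spacelike {x y : Spacetime s} (hx : x ∈ forwardCone s)
    (hy : y ∈ forwardCone s) (h : (y 0 / x 0) • x ≠ y) :
    ∃ m n : ℕ, 0 < m ∧ 0 < n ∧
      mink ((m : ℝ) • x - (n : ℝ) • y) ((m : ℝ) • x - (n : ℝ) • y) < 0 := by
  set r := y 0 / x 0 with hr
  have hr0 : 0 < r := div_pos hy.1 hx.1
  -- at the real ratio `r` the time component of the difference vanishes
  have hneg : mink (r • x - y) (r • x - y) < 0 := by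
    have hz : (r • x - y) 0 = 0 := by
      simp only [Pi.sub_apply, Pi.smul_apply, smul_eq_mul, hr]
      rw [div_mul_cancel₀ _ hx.1.ne', sub_self]
    have hspat : r • x - y = spatial fun i => (r • x - y) i.succ := by
      funext i
      exact Fin.cases hz (fun j => rfl) i
    rw [hspat]
    apply mink_spatial_neg
    intro h0
    rw [h0] at hspat
    apply h
    rw [← sub_eq_zero, hspat]
    funext i
    exact Fin.cases rfl (fun j => rfl) i
  have hc : Continuous fun t : ℝ => mink (t • x - y) (t • x - y) :=
    continuous_mink (by fun_prop) (by fun_prop)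
  have hopen : IsOpen ({t : ℝ | mink (t • x - y) (t • x - y) < 0} ∩ Set.Ioi 0) :=
    (isOpen_lt hc continuous_const).inter isOpen_Ioi
  obtain ⟨q, hq, hq0⟩ :=
    Rat.isDenseEmbedding_coe_real.dense.exists_mem_open hopen ⟨r, hneg, hr0⟩
  have hq0' : 0 < q := by
    have : (0 : ℝ) < q := hq0
    exact_mod_cast this
  have hden : (0 : ℝ) < q.den := by exact_mod_cast q.den_pos
  refine ⟨q.num.toNat, q.den, by have := Rat.num_pos.mpr hq0'; omega, q.den_pos, ?_⟩
  have hnum : ((q.num.toNat : ℕ) : ℝ) = q.den * (q : ℝ) := by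
    have h1 : ((q.num.toNat : ℕ) : ℤ) = q.num := Int.toNat_of_nonneg (Rat.num_pos.mpr hq0').le
    have h2 : ((q.num.toNat : ℕ) : ℝ) = (q.num : ℝ) := by 
      exact_mod_cast congrArg (Int.cast (R := ℝ)) h1
    rw [h2, Rat.cast_def, mul_div_cancel₀ _ hden.ne']
  have : (q.num.toNat : ℝ) • x - (q.den : ℝ) • y = (q.den : ℝ) • ((q : ℝ) • x - y) := by
    rw [hnum]; module
  rw [this, mink_smul_left, mink_smul_right]
  exact mul_neg_of_pos_of_neg hden (mul_neg_of_pos_of_neg hden hq)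

theorem exists_mem_forwardCone_not_proportional (hs : 1 ≤ s) (x : Spacetime s) :
    ∃ z ∈ forwardCone s, ∀ c : ℝ, c • x ≠ z := by
  by_contra hcon
  push Not at hcon
  obtain ⟨c, hc⟩ := hcon _ timeUnit_mem
  obtain ⟨d, hd⟩ := hcon (Fin.cons 2 (Pi.single ⟨0, hs⟩ 1)) (by
    constructor
    · simp
    · simp only [mink, Fin.cons_zero, Fin.cons_succ, Pi.single_apply]
      simp
      norm_num)
  have h1 := congrFun hc 0
  have h2 := congrFun hc (Fin.succ ⟨0, hs⟩)
  have h3 := congrFun hd (Fin.succ ⟨0, hs⟩)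
  simp only [Pi.smul_apply, smul_eq_mul, timeUnit_zero, timeUnit_succ, Fin.cons_succ,
    Pi.single_eq_same] at h1 h2 h3
  rcases mul_eq_zero.mp h2 with h | h
  · rw [h, zero_mul] at h1; exact zero_ne_one h1
  · rw [h, mul_zero] at h3; exact zero_ne_one h3

/-- An additive causal automorphism preserves or reverses the direction of time. Neither linearity
nor continuity is needed: the sign `ε` is all that is used. -/
theorem IsCausalAutomorphism.exists_sign (hs : 1 ≤ s) {κ : Spacetime s → Spacetime s}
    (hκ : IsCausalAutomorphism κ) (hadd : ∀ a b, κ (a + b) = κ a + κ b) :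
    ∃ ε : ℝ, (ε = 1 ∨ ε = -1) ∧ ∀ x, ε • κ x ∈ forwardCone s ↔ x ∈ forwardCone s := by
  let f : Spacetime s →+ Spacetime s := AddMonoidHom.mk' κ hadd
  have hneg : ∀ x, κ (-x) = -κ x := fun x => map_neg f x
  have hmul : ∀ (n : ℕ) x, κ ((n : ℝ) • x) = (n : ℝ) • κ x := by
    intro n x
    rw [Nat.cast_smul_eq_nsmul, Nat.cast_smul_eq_nsmul]
    exact map_nsmul f n x
  have hT : ∀ x, 0 < mink (κ x) (κ x) ↔ 0 < mink x x := by
    intro x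
    have h := hκ.timelike_iff x 0
    have h0 : κ 0 = 0 := map_zero f
    simpa [Timelike, h0] using h
  have hprop : ∀ x ∈ forwardCone s, ∀ y ∈ forwardCone s, κ x ∈ forwardCone s →
      -κ y ∈ forwardCone s → ((-κ y) 0 / κ x 0) • κ x = -κ y := by
    intro x hx y hy hX hY
    by_contra hne
    obtain ⟨m, n, hm, hn, h⟩ := exists_nat_smul_sub_spacelike hX hY hne
    have hpos : (m : ℝ) • x + (n : ℝ) • y ∈ forwardCone s :=
      add_mem_forwardCone (smul_mem_forwardCone (by exact_mod_cast hm) hx)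
        (forwardCone_subset (smul_mem_forwardCone (by exact_mod_cast hn) hy))
    have h2 := (hT _).mpr hpos.2
    rw [hadd, hmul, hmul] at h2
    rw [smul_neg, sub_neg_eq_add] at h
    linarith
  have hmixed : ∀ x ∈ forwardCone s, ∀ y ∈ forwardCone s, κ x ∈ forwardCone s →
      -κ y ∈ forwardCone s → False := by
    intro x hx y hy hX hY
    obtain ⟨z, hz, hzX⟩ := exists_mem_forwardCone_not_proportional hs (κ x)
    obtain ⟨w, rfl⟩ := hκ.bijective.2 z
    rcases mem_or_neg_mem_forwardCone ((hT w).mp hz.2) with hw | hw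
    · have h1 := hprop x hx y hy hX hY
      have h2 := hprop w hw y hy hz hY
      -- `κ w` and `κ x` are both proportional to `κ y`
      rw [← h1] at h2
      have hc : (-κ y) 0 / κ w 0 ≠ 0 := (div_pos hY.1 hz.1).ne'
      have : (((-κ y) 0 / κ w 0)⁻¹ * ((-κ y) 0 / κ x 0)) • κ x = κ w := by
        rw [mul_smul, inv_smul_eq_iff₀ hc]
        rw [h1] at h2 ⊢
        exact h2.symm
      exact hzX _ this
    · have h1 := hprop x hx (-w) hw hX (by rwa [hneg, neg_neg])
      rw [hneg, neg_neg] at h1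
      exact hzX _ h1
  have hcase : ∀ x ∈ forwardCone s, κ x ∈ forwardCone s ∨ -κ x ∈ forwardCone s := fun x hx =>
    mem_or_neg_mem_forwardCone ((hT x).mpr hx.2)
  have hanti : ∀ x : Spacetime s, x ∈ forwardCone s → -x ∉ forwardCone s := by
    intro x hx hx'
    have h1 := hx.1
    have h2 := hx'.1
    simp only [Pi.neg_apply] at h2
    linarith
  rcases hcase _ timeUnit_mem with h | h
  · refine ⟨1, Or.inl rfl, fun x => ?_⟩
    rw [one_smul]
    have hfwd : ∀ x ∈ forwardCone s, κ x ∈ forwardCone s := fun x hx =>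
      (hcase x hx).resolve_right fun h' => hmixed _ timeUnit_mem x hx h h'
    refine ⟨fun hx => ?_, hfwd x⟩
    refine (mem_or_neg_mem_forwardCone ((hT x).mp hx.2)).resolve_right fun h' => ?_
    have := hfwd _ h'
    rw [hneg] at this
    exact hanti _ hx this
  · refine ⟨-1, Or.inr rfl, fun x => ?_⟩
    rw [neg_one_smul]
    have hfwd : ∀ x ∈ forwardCone s, -κ x ∈ forwardCone s := fun x hx =>
      (hcase x hx).resolve_left fun h' => hmixed x hx _ timeUnit_mem h' h
    refine ⟨fun hx => ?_, hfwd x⟩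
    have hx' := (hT x).mp (by have := hx.2; rwa [mink_neg_left, mink_neg_right, neg_neg] at this)
    refine (mem_or_neg_mem_forwardCone hx').resolve_right fun h' => ?_
    have := hfwd _ h'
    rw [hneg] at this
    exact hanti _ hx this

/-- What remains of the causal automorphism `κ` in the argument: an additive bijection with
`ε κ(V₊) = V₊` for a sign `ε`. It maps the double cone with centre `p` and half-axis `v` onto the
one with centre `κ p` and half-axis `ε κ v`. -/
structure IsSignedConeMap (κ : Spacetime s → Spacetime s) (ε : ℝ) : Prop where
  bijective : Function.Bijective κ
  map_add : ∀ a b, κ (a + b) = κ a + κ b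
  sign : ε = 1 ∨ ε = -1
  mem_iff : ∀ x, ε • κ x ∈ forwardCone s ↔ x ∈ forwardCone s

namespace IsSignedConeMap

variable {κ : Spacetime s → Spacetime s} {ε : ℝ}

theorem map_neg (h : IsSignedConeMap κ ε) (a : Spacetime s) : κ (-a) = -κ a :=
  _root_.map_neg (AddMonoidHom.mk' κ h.map_add) a

theorem map_sub (h : IsSignedConeMap κ ε) (a b : Spacetime s) : κ (a - b) = κ a - κ b :=
  _root_.map_sub (AddMonoidHom.mk' κ h.map_add) a b

theorem map_zero (h : IsSignedConeMap κ ε) : κ 0 = 0 :=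
  _root_.map_zero (AddMonoidHom.mk' κ h.map_add)

theorem map_sign_smul (h : IsSignedConeMap κ ε) (a : Spacetime s) : κ (ε • a) = ε • κ a := by
  rcases h.sign with rfl | rfl
  · simp
  · simp [h.map_neg]

theorem sign_smul_sign_smul (h : IsSignedConeMap κ ε) (a : Spacetime s) : ε • ε • a = a := by
  rcases h.sign with rfl | rfl <;> simp

theorem map_inv_nat_smul (h : IsSignedConeMap κ ε) (n : ℕ) (a : Spacetime s) :
    κ (((n : ℝ) + 1)⁻¹ • a) = ((n : ℝ) + 1)⁻¹ • κ a := by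
  have hn : ((n + 1 : ℕ) : ℝ) ≠ 0 := by positivity
  have h1 : κ (((n + 1 : ℕ) : ℝ) • (((n + 1 : ℕ) : ℝ)⁻¹ • a))
      = ((n + 1 : ℕ) : ℝ) • κ (((n + 1 : ℕ) : ℝ)⁻¹ • a) := by
    rw [Nat.cast_smul_eq_nsmul, Nat.cast_smul_eq_nsmul]
    exact map_nsmul (AddMonoidHom.mk' κ h.map_add) (n + 1) _
  rw [smul_inv_smul₀ hn] at h1
  rw [h1]
  push_cast
  rw [inv_smul_smul₀ (by positivity)]

theorem symm (h : IsSignedConeMap κ ε) {κ' : Spacetime s → Spacetime s}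
    (hr : ∀ x, κ (κ' x) = x) (hl : ∀ x, κ' (κ x) = x) : IsSignedConeMap κ' ε where
  bijective := ⟨Function.LeftInverse.injective hr, Function.RightInverse.surjective hl⟩
  map_add a b := h.bijective.1 (by rw [h.map_add, hr, hr, hr])
  sign := h.sign
  mem_iff x := by
    rw [← h.mem_iff (ε • κ' x), h.map_sign_smul, h.sign_smul_sign_smul, hr]

theorem mem_centeredCone_iff (h : IsSignedConeMap κ ε) (ξ p v x : Spacetime s) :
    κ x + ξ ∈ (centeredCone (κ p + ξ) (ε • κ v)).carrier ↔ x ∈ (centeredCone p v).carrier := by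
  rw [mem_centeredCone, mem_centeredCone, add_sub_add_right_eq_sub, ← h.map_sub,
    ← h.mem_iff (v + (x - p)), ← h.mem_iff (v - (x - p)), h.map_add, h.map_sub v]
  rcases h.sign with rfl | rfl
  · simp only [one_smul]
  · simp only [neg_smul, one_smul, neg_add, neg_sub]
    rw [and_comm, ← sub_eq_add_neg (-κ v), neg_add_eq_sub (κ v)]

theorem image_centeredCone (h : IsSignedConeMap κ ε) (ξ p v : Spacetime s) :
    (fun x => κ x + ξ) '' (centeredCone p v).carrier
      = (centeredCone (κ p + ξ) (ε • κ v)).carrier := by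
  ext y
  constructor
  · rintro ⟨x, hx, rfl⟩
    exact (h.mem_centeredCone_iff ξ p v x).mpr hx
  · intro hy
    obtain ⟨x, hx⟩ := h.bijective.2 (y - ξ)
    have hxy : κ x + ξ = y := by rw [hx, sub_add_cancel]
    exact ⟨x, (h.mem_centeredCone_iff ξ p v x).mp (hxy ▸ hy), hxy⟩

end IsSignedConeMap

end CausalAutomorphism

/-! ### Localisation of the transformed algebras -/

section Conjugation

variable {H : Type*} [NormedAddCommGroup H] [InnerProductSpace ℂ H]
  {σ σ' : ℂ →+* ℂ} [RingHomInvPair σ σ'] [RingHomInvPair σ' σ]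

theorem conjBy_apply (K : H ≃ₛₗᵢ[σ] H) (A : H →L[ℂ] H) (ψ : H) :
    conjBy K A ψ = K (A (K.symm ψ)) := rfl

theorem conjBy_mul (K : H ≃ₛₗᵢ[σ] H) (A B : H →L[ℂ] H) :
    conjBy K (A * B) = conjBy K A * conjBy K B := by
  ext ψ; simp [conjBy_apply]

theorem conjBy_symm_conjBy (K : H ≃ₛₗᵢ[σ] H) (A : H →L[ℂ] H) :
    conjBy K.symm (conjBy K A) = A := by
  ext ψ; simp [conjBy_apply]

theorem conjBy_conjBy_symm (K : H ≃ₛₗᵢ[σ] H) (A : H →L[ℂ] H) :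
    conjBy K (conjBy K.symm A) = A := by
  ext ψ; simp [conjBy_apply]

theorem conjBy_smul_one (K : H ≃ₛₗᵢ[σ] H) (c : ℂ) :
    conjBy K (c • (1 : H →L[ℂ] H)) = σ c • (1 : H →L[ℂ] H) := by
  ext ψ
  simp [conjBy_apply, LinearIsometryEquiv.map_smulₛₗ]

end Conjugation

section Localisation

variable {s : ℕ} {H : Type*} [NormedAddCommGroup H] [InnerProductSpace ℂ H] [CompleteSpace H]
  {𝒜 : LocalNet s H} {U : TranslationRep s H} {Ω : H}
  {σ σ' : ℂ →+* ℂ} [RingHomInvPair σ σ'] [RingHomInvPair σ' σ]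

theorem LocalNet.algebra_mono (𝒜 : LocalNet s H) {R S : Set (Spacetime s)} (h : R ⊆ S) :
    𝒜.algebra R ≤ 𝒜.algebra S :=
  StarSubalgebra.topologicalClosure_mono <| iSup_le fun O =>
    le_iSup (fun O : {O : Region s // O.carrier ⊆ S} => 𝒜.alg O.1) ⟨O.1, O.2.trans h⟩

theorem LocalNet.alg_le_algebra (𝒜 : LocalNet s H) {O : Region s} {R : Set (Spacetime s)}
    (h : O.carrier ⊆ R) : 𝒜.alg O ≤ 𝒜.algebra R := by
  rw [← 𝒜.algebra_eq O]; exact 𝒜.algebra_mono h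

/-- Choice of a lightlike line along which the two locality conditions together give
commutativity. If `δ` exceeds `V` in the lightlike direction `e`, the line `b + ℝ e`, far away in a
spatial direction orthogonal to `e`, avoids the causal shadow of the double cone with half-axis `V`
for `t ≥ 0`, and that of a small double cone about `-δ` for `t ≤ 0`. -/
theorem exists_lightlike_line (hs : 2 ≤ s) {V δ e : Spacetime s} (hV : V ∈ forwardCone s)
    (hee : mink e e = 0) (he0 : 0 < e 0) (h : mink V e < mink δ e) :
    ∃ (b : Spacetime s) (η : ℝ), 0 < η ∧ ∀ r ≤ η, ∀ t : ℝ,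
      (V + (b + t • e) ∉ forwardCone s ∧ V - (b + t • e) ∉ forwardCone s) ∨
      (r • timeUnit s + (b + t • e + δ) ∉ forwardCone s ∧
        r • timeUnit s - (b + t • e + δ) ∉ forwardCone s) := by
  have he : e ∈ closedForwardCone s := ⟨he0.le, hee.ge⟩
  have hene : e ≠ 0 := by rintro rfl; simp at he0
  have hα0 : 0 < mink V e := mink_pos hV he hene
  obtain ⟨m, hm0, hm⟩ := exists_spatial_orthogonal hs e
  have hμe : mink e (spatial m) = 0 := by rw [mink_spatial_right, hm, neg_zero]
  have hμ := mink_spatial_neg hm0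
  -- `l` makes `b · e` the negative of the mean of `V · e` and `δ · e`
  set l : ℝ := -(mink V e + mink δ e) / (2 * e 0) with hl
  have hle : l * e 0 = -(mink V e + mink δ e) / 2 := by rw [hl]; field_simp
  set η : ℝ := (mink δ e - mink V e) / (4 * e 0) with hη
  have hηe : η * e 0 = (mink δ e - mink V e) / 4 := by rw [hη]; field_simp
  have hte : mink (timeUnit s) e = e 0 := by rw [mink_comm, mink_timeUnit_right]
  have hout : ∀ w : Spacetime s, mink w e ≤ 0 → w ∉ forwardCone s := fun w hw hw' =>
    absurd (mink_pos hw' he hene) (not_lt.mpr hw)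
  have hquad : ∀ (w : Spacetime s) (B t : ℝ),
      mink (w + B • spatial m + t • e) (w + B • spatial m + t • e)
        = mink (w + B • spatial m) (w + B • spatial m) + 2 * t * mink w e := by
    intro w B t
    simp only [mink_add_left, mink_add_right, mink_smul_left, mink_smul_right, hee, hμe,
      mink_comm (spatial m) e, mink_comm e w]
    ring
  obtain ⟨B, hB1, hB2⟩ := ((eventually_mink_add_smul_nonpos hμ (l • timeUnit s - V)).and
    (eventually_mink_add_smul_nonpos hμ (l • timeUnit s + δ + η • timeUnit s))).exists
  refine ⟨l • timeUnit s + B • spatial m, η, div_pos (by linarith) (by linarith),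
    fun r hr t => ?_⟩
  rcases le_total 0 t with ht | ht
  · refine Or.inl ⟨hout _ ?_, fun hmem => absurd hmem.2 (not_lt.mpr ?_)⟩
    · simp only [mink_add_left, mink_smul_left, hte, hee, mink_comm (spatial m) e, hμe]
      linarith
    · rw [show V - (l • timeUnit s + B • spatial m + t • e)
        = -(l • timeUnit s - V + B • spatial m + t • e) by abel, mink_neg_left, mink_neg_right,
        neg_neg, hquad, mink_sub_left, mink_smul_left, hte]
      have : t * (l * e 0 - mink V e) ≤ 0 := mul_nonpos_of_nonneg_of_nonpos ht (by linarith)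
      linarith
  · refine Or.inr ?_
    -- the region only grows with `r`, so that `r = η` may be assumed
    have hgrow : ∀ w : Spacetime s, r • timeUnit s + w ∈ forwardCone s →
        η • timeUnit s + w ∈ forwardCone s := by
      intro w hw
      rcases hr.eq_or_lt with rfl | hlt
      · exact hw
      · have := add_mem_forwardCone hw
          (forwardCone_subset (smul_mem_forwardCone (sub_pos.mpr hlt) timeUnit_mem))
        convert this using 1; module
    constructor
    · refine fun hmem => absurd (hgrow _ hmem).2 (not_lt.mpr ?_)
      rw [show η • timeUnit s + (l • timeUnit s + B • spatial m + t • e + δ)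
        = l • timeUnit s + δ + η • timeUnit s + B • spatial m + t • e by abel, hquad]
      have hwe : mink (l • timeUnit s + δ + η • timeUnit s) e
          = l * e 0 + mink δ e + η * e 0 := by
        simp only [mink_add_left, mink_smul_left, hte]
      have : t * (l * e 0 + mink δ e + η * e 0) ≤ 0 :=
        mul_nonpos_of_nonpos_of_nonneg ht (by linarith)
      rw [hwe]
      linarith
    · intro hmem
      rw [sub_eq_add_neg] at hmem
      refine hout _ ?_ (hgrow _ hmem)
      simp only [mink_add_left, mink_neg_left, mink_smul_left, hte, hee, mink_comm (spatial m) e,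
        hμe]
      linarith

/-- The hypotheses on the net, the translations and the vacuum. -/
structure VacuumNet (𝒜 : LocalNet s H) (U : TranslationRep s H) (Ω : H) : Prop where
  two_le : 2 ≤ s
  infinite : ¬ FiniteDimensional ℂ H
  covariant : TranslationCovariant 𝒜 U
  spectrum : SpectrumCondition U
  vacuum : IsVacuum 𝒜 U Ω
  reehSchlieder : ReehSchlieder 𝒜 Ω

variable {κ : Spacetime s → Spacetime s} {ε : ℝ} {K : H ≃ₛₗᵢ[σ] H}

theorem conj_op_mem {P : Region s} {R : Set (Spacetime s)}
    (hR : conjBy K '' (𝒜.alg P : Set (H →L[ℂ] H)) = 𝒜.algebra R) {X : H →L[ℂ] H}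
    (hX : X ∈ 𝒜.algebra R) : ∃ A ∈ 𝒜.alg P, conjBy K A = X := by
  have : X ∈ (𝒜.algebra R : Set (H →L[ℂ] H)) := hX
  rwa [← hR] at this

/-- Locality for the transformed net: the translate by `c` of the image of the double cone
`(q, w)` commutes with the image of the double cone `(p, v)` as soon as the double cones
`(κ p, ε κ v)` and `(κ q + c, ε κ w)` are spacelike separated. -/
theorem commute_conj_of_spacelike (hA : TranslationCovariant 𝒜 U) (hκ : IsSignedConeMap κ ε)
    (hKU : ∀ a, conjBy K (U.op a) = U.op (κ a)) {p v q w c : Spacetime s}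
    (h1 : ε • κ (v + w) + (κ (q - p) + c) ∉ forwardCone s)
    (h2 : ε • κ (v + w) - (κ (q - p) + c) ∉ forwardCone s) {A B : H →L[ℂ] H}
    (hAp : A ∈ 𝒜.alg (centeredCone p v)) (hBq : B ∈ 𝒜.alg (centeredCone q w)) :
    conjBy K A * (U.op c * conjBy K B * U.op (-c))
      = (U.op c * conjBy K B * U.op (-c)) * conjBy K A := by
  obtain ⟨a, rfl⟩ := hκ.bijective.2 c
  rw [← hκ.map_add] at h1 h2
  have hsep : SpacelikeSeparated (centeredCone p v).carrier (centeredCone (q + a) w).carrier := by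
    have e1 : q + a - p = q - p + a := by abel
    rcases hκ.sign with rfl | rfl
    · refine spacelikeSeparated_doubleCone (fun h => h1 ?_) (fun h => h2 ?_)
      · rw [e1, ← hκ.mem_iff, hκ.map_add (v + w), smul_add, one_smul _ (κ (_ + a))] at h
        exact h
      · rw [e1, ← hκ.mem_iff, hκ.map_sub (v + w), smul_sub, one_smul _ (κ (_ + a))] at h
        exact h
    · refine spacelikeSeparated_doubleCone (fun h => h2 ?_) (fun h => h1 ?_)
      · rw [e1, ← hκ.mem_iff, hκ.map_add (v + w), smul_add, neg_one_smul _ (κ (_ + a)),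
          ← sub_eq_add_neg] at h
        exact h
      · rw [e1, ← hκ.mem_iff, hκ.map_sub (v + w), smul_sub, neg_one_smul _ (κ (_ + a)),
          sub_neg_eq_add] at h
        exact h
  rw [← hκ.map_neg, ← hKU, ← hKU, ← conjBy_mul, ← conjBy_mul, ← conjBy_mul, ← conjBy_mul]
  congr 1
  refine 𝒜.locality _ _ hsep A hAp _ ?_
  rw [← centeredCone_translate]
  exact hA.conj_mem hBq a

/-- Points of the regions in which the images of two double cones are localised: relative to the
`κ`-images of the centres, they differ by less than the sum of the half-axes. -/
theorem VacuumNet.sub_mem_closedForwardCone (hN : VacuumNet 𝒜 U Ω) (hκ : IsSignedConeMap κ ε)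
    (hKU : ∀ a, conjBy K (U.op a) = U.op (κ a)) {p v q w : Spacetime s}
    (hv : v ∈ forwardCone s) (hw : w ∈ forwardCone s) {M N : Set (Spacetime s)}
    (hM : IsOpen M) (hN' : IsOpen N)
    (hKM : conjBy K '' (𝒜.alg (centeredCone p v) : Set (H →L[ℂ] H)) = 𝒜.algebra M)
    (hKN : conjBy K '' (𝒜.alg (centeredCone q w) : Set (H →L[ℂ] H)) = 𝒜.algebra N)
    {x y : Spacetime s} (hx : x ∈ M) (hy : y ∈ N) :
    ε • κ (v + w) - ((y - κ q) - (x - κ p)) ∈ closedForwardCone s := by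
  refine mem_closedForwardCone_of_lightlike (by have := hN.two_le; omega) fun e hee he0 => ?_
  by_contra hlt
  rw [mink_sub_left, not_le, sub_neg] at hlt
  obtain ⟨b, η, hη, hline⟩ := exists_lightlike_line hN.two_le
    ((hκ.mem_iff _).mpr (add_mem_forwardCone hv (forwardCone_subset hw))) hee he0 hlt
  obtain ⟨r₁, hr₁, hball₁⟩ := Metric.nhds_basis_closedBall.mem_iff.mp (hM.mem_nhds hx)
  obtain ⟨r₂, hr₂, hball₂⟩ := Metric.nhds_basis_closedBall.mem_iff.mp (hN'.mem_nhds hy)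
  obtain ⟨r, hr, hrmin⟩ : ∃ r : ℝ, 0 < r ∧ r ≤ min (η / 2) (min r₁ r₂) :=
    ⟨_, lt_min (half_pos hη) (lt_min hr₁ hr₂), le_rfl⟩
  rw [le_min_iff, le_min_iff] at hrmin
  have hr0 : (r • timeUnit s) 0 = r := by simp
  have hcone := smul_mem_forwardCone hr (timeUnit_mem (s := s))
  have hxM : (centeredCone x (r • timeUnit s)).carrier ⊆ M := fun z hz =>
    hball₁ (Metric.closedBall_subset_closedBall (hr0.le.trans hrmin.2.1)
      (centeredCone_subset_ball _ _ hz))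
  have hyN : (centeredCone y (r • timeUnit s)).carrier ⊆ N := fun z hz =>
    hball₂ (Metric.closedBall_subset_closedBall (hr0.le.trans hrmin.2.2)
      (centeredCone_subset_ball _ _ hz))
  refine not_forall_commute_along_causal_line hN.two_le hN.infinite hN.covariant hN.spectrum
    hN.vacuum hN.reehSchlieder (centeredCone_nonempty x hcone)
    (centeredCone_nonempty (y + (b - κ (q - p))) hcone)
    (e := e) ⟨he0.le, hee.ge⟩ (by rintro rfl; simp at he0) fun t X hX Y hY => ?_
  rw [centeredCone_translate] at hY
  rcases hline (2 * r) (by linarith) t with ⟨h1, h2⟩ | ⟨h1, h2⟩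
  · rw [add_assoc, ← centeredCone_translate] at hY
    obtain ⟨Y', hY', rfl⟩ := hN.covariant.exists_eq_conj hY
    obtain ⟨A, hAp, rfl⟩ := conj_op_mem hKM (𝒜.alg_le_algebra hxM hX)
    obtain ⟨B, hBq, rfl⟩ := conj_op_mem hKN (𝒜.alg_le_algebra hyN hY')
    have e1 : κ (q - p) + (b - κ (q - p) + t • e) = b + t • e := by abel
    exact commute_conj_of_spacelike hN.covariant hκ hKU (by rwa [e1]) (by rwa [e1]) hAp hBq
  · refine 𝒜.locality _ _ ?_ X hX Y hY
    have e1 : r • timeUnit s + r • timeUnit s = (2 * r) • timeUnit s := by module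
    have e2 : y + (b - κ (q - p)) + t • e - x = b + t • e + (y - κ q - (x - κ p)) := by
      rw [hκ.map_sub]; abel
    exact spacelikeSeparated_doubleCone (by rwa [e1, e2]) (by rwa [e1, e2])

/-- The image of the algebra of a nonempty double cone is not localised in the empty set. -/
theorem VacuumNet.nonempty_of_conj (hN : VacuumNet 𝒜 U Ω) {p v : Spacetime s}
    (hv : v ∈ forwardCone s) {M : Set (Spacetime s)}
    (hKM : conjBy K '' (𝒜.alg (centeredCone p v) : Set (H →L[ℂ] H)) = 𝒜.algebra M) :
    M.Nonempty := by
  by_contra hM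
  rw [Set.not_nonempty_iff_eq_empty] at hM
  subst hM
  refine not_forall_commute_along_causal_line hN.two_le hN.infinite hN.covariant hN.spectrum
    hN.vacuum hN.reehSchlieder (centeredCone_nonempty p hv) (centeredCone_nonempty p hv)
    (forwardCone_subset timeUnit_mem) (e := timeUnit s) ?_ fun t A hAp B _ => ?_
  · intro h0; simpa using congrFun h0 0
  · have hE := 𝒜.algebra_eq ⟨∅, isOpen_empty, Bornology.isBounded_empty⟩
    have hmem : conjBy K A ∈ (𝒜.algebra ∅ : Set (H →L[ℂ] H)) := by rw [← hKM]; exact ⟨A, hAp, rfl⟩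
    rw [hE] at hmem
    obtain ⟨c, hc⟩ := exists_eq_smul_one_of_empty hN.covariant hN.spectrum hN.vacuum
      hN.reehSchlieder rfl hmem
    rw [← conjBy_symm_conjBy K A, hc, conjBy_smul_one]
    simp

/-- The one-sided localisation statement: a single translation `ξ` localises the images of all
double cones. It is the limit of points in the localisation regions of shrinking double cones
about the origin. -/
theorem VacuumNet.exists_localisation (hN : VacuumNet 𝒜 U Ω) (hκ : IsSignedConeMap κ ε)
    (hKU : ∀ a, conjBy K (U.op a) = U.op (κ a))
    (hK : ∀ p v : Spacetime s, ∃ M : Set (Spacetime s), IsOpen M ∧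
      conjBy K '' (𝒜.alg (centeredCone p v) : Set (H →L[ℂ] H)) = 𝒜.algebra M) :
    ∃ ξ : Spacetime s, ∀ p, ∀ v ∈ forwardCone s, ∀ A ∈ 𝒜.alg (centeredCone p v),
      conjBy K A ∈ 𝒜.alg (centeredCone (κ p + ξ) (ε • κ v)) := by
  choose M hMo hM using hK
  set v₀ : ℕ → Spacetime s := fun n => ((n : ℝ) + 1)⁻¹ • timeUnit s with hv₀
  have hv₀mem : ∀ n, v₀ n ∈ forwardCone s := fun n =>
    smul_mem_forwardCone (by positivity) timeUnit_mem
  set T := ε • κ (timeUnit s) with hT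
  have hTmem : T ∈ forwardCone s := (hκ.mem_iff _).mpr timeUnit_mem
  have hκv : ∀ n, ε • κ (v₀ n) = ((n : ℝ) + 1)⁻¹ • T := fun n => by
    rw [hv₀, hκ.map_inv_nat_smul, smul_comm]
  have hne : ∀ n, (M 0 (v₀ n)).Nonempty := fun n => hN.nonempty_of_conj (hv₀mem n) (hM _ _)
  choose z hz using hne
  -- both orders of the two double cones give a two-sided bound
  have hbound : ∀ p v q w x y, v ∈ forwardCone s → w ∈ forwardCone s → x ∈ M p v → y ∈ M q w →
      ε • κ v + ε • κ w + ((y - κ q) - (x - κ p)) ∈ closedForwardCone s ∧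
      ε • κ v + ε • κ w - ((y - κ q) - (x - κ p)) ∈ closedForwardCone s := by
    intro p v q w x y hv hw hx hy
    have h1 := hN.sub_mem_closedForwardCone hκ hKU hv hw (hMo _ _) (hMo _ _) (hM _ _) (hM _ _) hx hy
    have h2 := hN.sub_mem_closedForwardCone hκ hKU hw hv (hMo _ _) (hMo _ _) (hM _ _) (hM _ _) hy hx
    rw [hκ.map_add, smul_add] at h1 h2
    refine ⟨?_, h1⟩
    convert h2 using 1; abel
  have hlim0 : Filter.Tendsto (fun n : ℕ => ((n : ℝ) + 1)⁻¹) Filter.atTop (nhds 0) := by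
    simpa only [one_div] using tendsto_one_div_add_atTop_nhds_zero_nat (𝕜 := ℝ)
  have hcauchy : CauchySeq z := by
    refine cauchySeq_of_le_tendsto_0 (fun n : ℕ => ((n : ℝ) + 1)⁻¹ * (2 * T 0)) ?_
      (by simpa using hlim0.mul_const (2 * T 0))
    intro n m N hn hm
    obtain ⟨h1, h2⟩ := hbound 0 (v₀ n) 0 (v₀ m) _ _ (hv₀mem n) (hv₀mem m) (hz n) (hz m)
    have h3 := norm_le_of_mem h1 h2
    rw [hκ.map_zero, sub_zero, sub_zero, hκv, hκv] at h3
    simp only [Pi.add_apply, Pi.smul_apply, smul_eq_mul] at h3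
    rw [dist_comm, dist_eq_norm]
    refine h3.trans ?_
    have hle : ∀ k : ℕ, N ≤ k → ((k : ℝ) + 1)⁻¹ ≤ ((N : ℝ) + 1)⁻¹ := fun k hk =>
      inv_anti₀ (by positivity) (by exact_mod_cast Nat.succ_le_succ hk)
    nlinarith [hle n hn, hle m hm, hTmem.1]
  obtain ⟨ξ, hξ⟩ := cauchySeq_tendsto_of_complete hcauchy
  refine ⟨ξ, fun p v hv A hAp => ?_⟩
  have hclosed : ∀ x ∈ M p v, ε • κ v + (x - (κ p + ξ)) ∈ closedForwardCone s ∧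
      ε • κ v - (x - (κ p + ξ)) ∈ closedForwardCone s := by
    intro x hx
    have hlimT : Filter.Tendsto (fun n : ℕ => ε • κ v + ε • κ (v₀ n)) Filter.atTop
        (nhds (ε • κ v)) := by
      simp only [hκv]
      simpa using (tendsto_const_nhds (x := ε • κ v)).add (hlim0.smul_const T)
    have hlimz : Filter.Tendsto (fun n : ℕ => (z n - κ 0) - (x - κ p)) Filter.atTop
        (nhds (ξ - (x - κ p))) := by
      rw [hκ.map_zero]
      simpa using hξ.sub_const (x - κ p)
    constructor
    · have := isClosed_closedForwardCone.mem_of_tendsto (hlimT.sub hlimz)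
        (Filter.Eventually.of_forall fun n =>
          (hbound p v 0 (v₀ n) x (z n) hv (hv₀mem n) hx (hz n)).2)
      convert this using 1; abel
    · have := isClosed_closedForwardCone.mem_of_tendsto (hlimT.add hlimz)
        (Filter.Eventually.of_forall fun n =>
          (hbound p v 0 (v₀ n) x (z n) hv (hv₀mem n) hx (hz n)).1)
      convert this using 1; abel
  -- an open set inside the closed double cone is contained in the open one
  have hsub : M p v ⊆ (centeredCone (κ p + ξ) (ε • κ v)).carrier := by
    intro x hx
    have hc : Continuous fun τ : ℝ => (x - τ • timeUnit s, x + τ • timeUnit s) := by fun_prop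
    have hmem : ∀ᶠ τ in nhds (0 : ℝ), x - τ • timeUnit s ∈ M p v ∧ x + τ • timeUnit s ∈ M p v :=
      hc.continuousAt.eventually_mem (s := M p v ×ˢ M p v)
        (by simpa using ((hMo p v).prod (hMo p v)).mem_nhds ⟨hx, hx⟩)
    obtain ⟨τ, ⟨hτ1, hτ2⟩, hpos⟩ := ((hmem.filter_mono nhdsWithin_le_nhds).and
      (self_mem_nhdsWithin (s := Set.Ioi (0 : ℝ)))).exists
    have hτ := smul_mem_forwardCone hpos (timeUnit_mem (s := s))
    rw [mem_centeredCone]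
    constructor
    · convert add_mem_forwardCone hτ (hclosed _ hτ1).1 using 1; abel
    · convert add_mem_forwardCone hτ (hclosed _ hτ2).2 using 1; abel
  have hmem : conjBy K A ∈ (𝒜.algebra (M p v) : Set (H →L[ℂ] H)) := by
    rw [← hM]; exact ⟨A, hAp, rfl⟩
  rw [← 𝒜.algebra_eq]
  exact 𝒜.algebra_mono hsub hmem

end Localisation

/-! ### The geometric action -/

theorem lemma1 {s : ℕ} (hs : 2 ≤ s)
    {H : Type*} [NormedAddCommGroup H] [InnerProductSpace ℂ H] [CompleteSpace H]
    (hH : ¬ FiniteDimensional ℂ H)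
    (𝒜 : LocalNet s H) (U : TranslationRep s H) (Ω : H)
    (hA : TranslationCovariant 𝒜 U) (hB : SpectrumCondition U)
    (hC : IsVacuum 𝒜 U Ω) (hD : ReehSchlieder 𝒜 Ω)
    {σ σ' : ℂ →+* ℂ} [RingHomInvPair σ σ'] [RingHomInvPair σ' σ]
    (hσ : σ = RingHom.id ℂ ∨ σ = starRingEnd ℂ)
    (K : H ≃ₛₗᵢ[σ] H)
    (hK : ∀ a b : Spacetime s,
      (∃ M : Set (Spacetime s), IsOpen M ∧
        conjBy K '' (𝒜.algebra (doubleCone a b) : Set (H →L[ℂ] H)) = 𝒜.algebra M) ∧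
      (∃ N : Set (Spacetime s), IsOpen N ∧
        conjBy K.symm '' (𝒜.algebra (doubleCone a b) : Set (H →L[ℂ] H)) = 𝒜.algebra N))
    (κ : Spacetime s → Spacetime s) (hκ : IsCausalAutomorphism κ)
    (hKU : ∀ a : Spacetime s, conjBy K (U.op a) = U.op (κ a)) :
    ∃! ξ : Spacetime s, ∀ a b : Spacetime s,
      conjBy K '' (𝒜.algebra (doubleCone a b) : Set (H →L[ℂ] H)) =
        𝒜.algebra ((fun x => κ x + ξ) '' doubleCone a b) := by
  have hN : VacuumNet 𝒜 U Ω := ⟨hs, hH, hA, hB, hC, hD⟩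
  -- `κ` is additive since translations act faithfully
  have hadd : ∀ a b, κ (a + b) = κ a + κ b := by
    intro a b
    have h1 : U.op (κ (a + b)) = U.op (κ a + κ b) := by
      rw [← hKU, U.op_add, conjBy_mul, hKU, hKU, U.op_add]
    refine sub_eq_zero.mp (eq_zero_of_op_eq_one hs hH hA hB hC hD ?_)
    rw [sub_eq_add_neg, U.op_add, h1, U.op_mul_op_neg]
  obtain ⟨ε, hε, hmem⟩ := hκ.exists_sign (by omega) hadd
  have hS : IsSignedConeMap κ ε := ⟨hκ.bijective, hadd, hε, hmem⟩
  obtain ⟨κ', hl, hr⟩ := Function.bijective_iff_has_inverse.mp hκ.bijective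
  have hS' : IsSignedConeMap κ' ε := hS.symm hr hl
  have hKU' : ∀ a, conjBy K.symm (U.op a) = U.op (κ' a) := by
    intro a
    nth_rewrite 1 [← hr a]
    rw [← hKU, conjBy_symm_conjBy]
  obtain ⟨ξ, hξ⟩ := hN.exists_localisation hS hKU fun p v => by
    rw [← 𝒜.algebra_eq]; exact (hK _ _).1
  obtain ⟨ξ', hξ'⟩ := hN.exists_localisation hS' hKU' fun p v => by
    rw [← 𝒜.algebra_eq]; exact (hK _ _).2
  have hback : ∀ p, ∀ v ∈ forwardCone s, ∀ B ∈ 𝒜.alg (centeredCone (κ p + ξ) (ε • κ v)),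
      conjBy K.symm B ∈ 𝒜.alg (centeredCone (p + (κ' ξ + ξ')) v) := by
    intro p v hv B hBp
    have := hξ' _ _ ((hmem v).mpr hv) B hBp
    rwa [hS'.map_add, hl, hS'.map_sign_smul, hl, hS.sign_smul_sign_smul, add_assoc] at this
  -- going there and back shifts the net by a constant vector, which must vanish
  have hzero : κ' ξ + ξ' = 0 := by
    refine eq_zero_of_alg_le hs hH hA hB hC hD fun p A hAp => ?_
    have := hback p _ timeUnit_mem _ (hξ p _ timeUnit_mem A hAp)
    rwa [conjBy_symm_conjBy] at this
  simp only [hzero, add_zero] at hback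
  have himage : ∀ ξ a b, 𝒜.algebra ((fun x => κ x + ξ) '' doubleCone a b)
      = 𝒜.alg (centeredCone (κ ((2⁻¹ : ℝ) • (a + b)) + ξ) (ε • κ ((2⁻¹ : ℝ) • (b - a)))) := by
    intro ξ a b
    rw [doubleCone_eq_centeredCone, hS.image_centeredCone, 𝒜.algebra_eq]
  refine ⟨ξ, fun a b => ?_, fun ξ₂ hξ₂ => ?_⟩
  · rw [himage, doubleCone_eq_centeredCone, 𝒜.algebra_eq]
    set p := (2⁻¹ : ℝ) • (a + b)
    set v := (2⁻¹ : ℝ) • (b - a)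
    by_cases hv : v ∈ forwardCone s
    · ext B
      constructor
      · rintro ⟨A, hAp, rfl⟩
        exact hξ p v hv A hAp
      · intro hBp
        exact ⟨_, hback p v hv B hBp, conjBy_conjBy_symm K B⟩
    · -- both regions are empty, and their algebras consist of scalars
      have hempty : ∀ p w : Spacetime s, w ∉ forwardCone s → (centeredCone p w).carrier = ∅ := by
        intro p w hw
        rw [Set.eq_empty_iff_forall_notMem]
        intro x hx
        rw [mem_centeredCone] at hx
        apply hw
        have h2 := smul_mem_forwardCone (c := 2⁻¹) (by norm_num)
          (add_mem_forwardCone hx.1 (forwardCone_subset hx.2))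
        convert h2 using 1; module
      have hscalar : ∀ p w : Spacetime s, w ∉ forwardCone s →
          (𝒜.alg (centeredCone p w) : Set (H →L[ℂ] H)) = Set.range fun c : ℂ => c • 1 := by
        intro p w hw
        ext A
        constructor
        · intro hAp
          obtain ⟨c, rfl⟩ := exists_eq_smul_one_of_empty hA hB hC hD (hempty p w hw) hAp
          exact ⟨c, rfl⟩
        · rintro ⟨c, rfl⟩
          exact (𝒜.alg (centeredCone p w)).smul_mem (one_mem _) c
      rw [hscalar p v hv, hscalar _ _ ((hmem v).not.mpr hv), ← Set.range_comp]
      ext A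
      constructor
      · rintro ⟨c, rfl⟩
        exact ⟨σ c, (conjBy_smul_one K c).symm⟩
      · rintro ⟨c, rfl⟩
        refine ⟨σ' c, ?_⟩
        simp only [Function.comp_apply, conjBy_smul_one, RingHomInvPair.comp_apply_eq₂]
  · -- test with double cones whose images have half-axis `timeUnit s`
    obtain ⟨v, hv⟩ := hκ.bijective.2 (ε • timeUnit s)
    have hεv : ε • κ v = timeUnit s := by rw [hv, hS.sign_smul_sign_smul]
    have hvmem : v ∈ forwardCone s := (hmem v).mp (hεv ▸ timeUnit_mem)
    refine sub_eq_zero.mp (eq_zero_of_alg_le hs hH hA hB hC hD fun q B hBq => ?_)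
    obtain ⟨p, hp⟩ := hκ.bijective.2 (q - ξ)
    have hq : κ p + ξ = q := by rw [hp, sub_add_cancel]
    have h1 := hback p v hvmem B (by rwa [hεv, hq])
    have h2 := hξ₂ (p - v) (p + v)
    rw [← centeredCone_carrier, hS.image_centeredCone, 𝒜.algebra_eq, 𝒜.algebra_eq, hεv] at h2
    have h3 : B ∈ (𝒜.alg (centeredCone (κ p + ξ₂) (timeUnit s)) : Set (H →L[ℂ] H)) := by
      rw [← h2]; exact ⟨_, h1, conjBy_conjBy_symm K B⟩
    have e1 : κ p + ξ₂ = q + (ξ₂ - ξ) := by rw [← hq]; abel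
    rwa [e1] at h3
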